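/- Let $\Gamma(1)=\mathrm{PSL}_2(\mathbb Z)$ act on the upper half plane $\mathbb H$ by Möbius transformations, and equip $\mathbb H$ with the hyperbolic measure $dx\,dy/y^2$. Let $\Gamma\subset\Gamma(1)$ be a torsion-free normal subgroup of finite index and $\Gamma_{\rm par}\subset\Gamma$ the subgroup generated by all parabolic elements of $\Gamma$. Let $I_\Gamma\subset\mathbb C[\Gamma]$ be the augmentation ideal, and for $q\ge 0$ put $J_{q+1}=I_\Gamma^{q+1}+\mathbb C[\Gamma]\,I_{\Gamma_{\rm par}}$. Let $\Gamma(1)$ act on functions on $\mathbb H$ by $(\gamma f)(z)=f(\gamma^{-1}z)$, and let $F_q$ be the space of all measurable functions $f:\mathbb H\to\mathbb C$ with $J_{q+1}f=0$, all modulo null functions. Let $\mathbb H_\Gamma\supset\mathbb H$ be the Borel–Serre space, in which to every cusp $c$ of $\Gamma$ the real line $\mathbb P^1(\mathbb R)\smallsetminus\{c\}$ is attached. If $c=g\infty$ with $g\in \mathrm{SL}_2(\mathbb R)$, the point $gx$ ($x\in\mathbb R$) of this line has as basic neighbourhoods the sets consisting of $g\{z:|\mathrm{Re}\,z-x|<\varepsilon,\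 \mathrm{Im}\,z>1/\varepsilon\}$ and all $gx'$ with $|x'-x|<\varepsilon$. The boundary $\mathbb H_\Gamma\smallsetminus\mathbb H$ is given measure zero. Let $L^2_q(\Gamma\backslash\mathbb H)$ be the space of all $f\in F_q$ that lie in $L^2_{\rm loc}(\mathbb H_\Gamma)$, i.e. are square integrable on some neighbourhood of every point of $\mathbb H_\Gamma$. Let $S$ be a finite symmetric set of generators of $\Gamma$ with $1\in S$, and let $D\subset\mathbb H$ be a closed fundamental domain of $\Gamma$ with finitely many geodesic sides: $D$ is closed, its translates $\gamma D$ $(\gamma\in\Gamma)$ cover $\mathbb H$, have pairwise disjoint interiors and form a locally finite family in $\mathbb H$, and the boundary of $D$ is a finite union of geodesic arcs. Put $S^qD=\bigcup_{s_1,\dots,s_q\in S}s_1\cdots s_qD$. Then for every $q\ge0$ the following hold. 1. Every $f\in F_q$ is uniquely determined by its restriction to $S^qD$. 2. $F_q\cap L^2(S^qD)=L^2_q(\Gamma\backslash\mathbb H)$; that is, an element of $F_q$ is square integrable on $S^qD$ if and only if it lies in $L^2_q(\Gamma\backslash\mathbb H)$. 3. Restriction to $S^qD$ identifies $L^2_q(\Gamma\backslash\mathbb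 H)$ with a closed subspace of the Hilbert space $L^2(S^qD)$. 4. The induced Hilbert space topology on $L^2_q(\Gamma\backslash\mathbb H)$ does not depend on the choice of $S$ and $D$. For $q\ge1$ the inner product does: for every choice $(S,D)$ there is another choice that induces a different inner product. 5. The group $\Gamma(1)$ preserves $L^2_q(\Gamma\backslash\mathbb H)$ and acts on it continuously. With respect to the inner product induced by $(S,D)$ this action is unitary if and only if $q=0$ or there is no nonzero group homomorphism $\Gamma/\Gamma_{\rm par}\to(\mathbb C,+)$. In particular, if such a homomorphism exists, the action is unitary for $q=0$ and not unitary for every $q\ge1$. -/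

import Mathlib

open scoped MatrixGroups Pointwise Topology
open MeasureTheory UpperHalfPlane

noncomputable section

/-! ### Higher order invariants -/

section HigherInvariants

variable {G : Type*} [Group G]

/-- The augmentation ideal `I_G` of `ℂ[G]`: the kernel of `∑ c_g g ↦ ∑ c_g`. -/
def augIdeal (G : Type*) [Group G] : Ideal (MonoidAlgebra ℂ G) :=
  RingHom.ker (MonoidAlgebra.lift ℂ ℂ G (1 : G →* ℂ))

/-- The left ideal `ℂ[G] I_P` of `ℂ[G]` generated by the augmentation ideal of a subgroup `P`. -/
def relAugIdeal (P : Subgroup G) : Ideal (MonoidAlgebra ℂ G) :=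
  Ideal.span (MonoidAlgebra.mapDomainRingHom ℂ P.subtype '' (augIdeal P : Set (MonoidAlgebra ℂ P)))

/-- The ideal `J_q = I_G ^ q + ℂ[G] I_P`. -/
def orderIdeal (P : Subgroup G) (q : ℕ) : Ideal (MonoidAlgebra ℂ G) :=
  augIdeal G ^ q ⊔ relAugIdeal P

/-- The invariants of type `P` and order `q` of a `ℂ[G]`-module `W`: all `w` with
`J_{q+1} w = 0`. -/
def higherInvariants {W : Type*} [AddCommGroup W] [Module ℂ W] (ρ : Representation ℂ G W)
    (P : Subgroup G) (q : ℕ) : Submodule ℂ W :=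
  ⨅ x ∈ orderIdeal P (q + 1), LinearMap.ker (ρ.asAlgebraHom x)

end HigherInvariants

/-! ### The modular group `Γ(1) = PSL(2, ℤ)` acting on the upper half plane -/

theorem center_SL2Z_smul (g : SL(2, ℤ)) (hg : g ∈ Subgroup.center SL(2, ℤ)) (z : ℍ) :
    g • z = z := by
  obtain ⟨r, hr, hg⟩ := Matrix.SpecialLinearGroup.mem_center_iff.mp hg
  have hr2 : r * r = 1 := by simpa [sq] using hr
  rcases mul_self_eq_one_iff.mp hr2 with h | h
  · have : g = 1 := by
      ext i j
      rw [← hg, h]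
      simp
    simp [this]
  · have : g = -1 := by
      ext i j
      rw [← hg, h]
      simp
    rw [this, ModularGroup.SL_neg_smul, one_smul]

/-- The action of `PSL(2, ℤ)` on the upper half plane by Möbius transformations. -/
instance : MulAction PSL(2, ℤ) ℍ :=
  MulAction.compHom ℍ (QuotientGroup.lift (Subgroup.center SL(2, ℤ))
    (MulAction.toPermHom SL(2, ℤ) ℍ)
    (fun g hg => Equiv.ext fun z => center_SL2Z_smul g hg z))

theorem PSL2Z_mk_smul (g : SL(2, ℤ)) (z : ℍ) : ((g : PSL(2, ℤ)) • z : ℍ) = g • z := rfl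

instance : ContinuousConstSMul PSL(2, ℤ) ℍ where
  continuous_const_smul γ := by
    induction γ using QuotientGroup.induction_on with
    | H g => exact continuous_const_smul (Matrix.SpecialLinearGroup.mapGL ℝ g)

instance : SMulInvariantMeasure PSL(2, ℤ) ℍ volume where
  measure_preimage_smul γ s hs := by
    induction γ using QuotientGroup.induction_on with
    | H g => exact measure_preimage_smul_of_nullMeasurableSet hs.nullMeasurableSet
                (Matrix.SpecialLinearGroup.mapGL ℝ g)

/-- The action of `PSL(2, ℤ)` on measurable functions on `ℍ` modulo null functions (with respect
to the hyperbolic measure): `(γ f)(z) = f (γ⁻¹ z)`. -/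
def translation : Representation ℂ PSL(2, ℤ) (ℍ →ₘ[volume] ℂ) where
  toFun γ :=
    { toFun := fun f => DomMulAct.mk γ⁻¹ • f
      map_add' := fun f g => smul_add _ f g
      map_smul' := fun c f => smul_comm _ c f }
  map_one' := by
    ext1 f
    change DomMulAct.mk (1 : PSL(2, ℤ))⁻¹ • f = f
    rw [inv_one, DomMulAct.mk_one, one_smul]
  map_mul' γ δ := by
    ext1 f
    change DomMulAct.mk (γ * δ)⁻¹ • f = DomMulAct.mk γ⁻¹ • DomMulAct.mk δ⁻¹ • f
    rw [mul_inv_rev, DomMulAct.mk_mul, mul_smul]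

theorem translation_ae (γ : PSL(2, ℤ)) (f : ℍ →ₘ[volume] ℂ) :
    translation γ f =ᵐ[volume] fun z => f (γ⁻¹ • z) :=
  DomMulAct.smul_aeeqFun_aeeq (DomMulAct.mk γ⁻¹) f

variable (Γ : Subgroup PSL(2, ℤ))

/-- The subgroup of `Γ` generated by its parabolic elements. -/
def parSubgroup : Subgroup Γ :=
  Subgroup.closure {γ : Γ | ∃ g : SL(2, ℤ), (g : PSL(2, ℤ)) = γ ∧
    (Matrix.SpecialLinearGroup.mapGL ℝ g).IsParabolic}

/-- The space `F_q` of measurable functions `f : ℍ → ℂ` with `J_{q+1} f = 0`,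
modulo null functions. -/
def formsF (q : ℕ) : Submodule ℂ (ℍ →ₘ[volume] ℂ) :=
  higherInvariants (translation.comp Γ.subtype) (parSubgroup Γ) q

/-! ### The Borel-Serre space -/

/-- The preimage of `Γ` in `SL(2, ℤ)`, as a subgroup of `GL(2, ℝ)`. -/
def liftGL : Subgroup (GL (Fin 2) ℝ) :=
  (Γ.comap (QuotientGroup.mk' (Subgroup.center SL(2, ℤ)))).map (Matrix.SpecialLinearGroup.mapGL ℝ)

/-- The space `ℍ_Γ`: the upper half plane with a real line attached to each cusp `c` of `Γ`,
namely the line `ℙ¹(ℝ) ∖ {c}` of (feet of) geodesics ending in `c`. -/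
inductive BorelSerre
  | inner (z : ℍ) : BorelSerre
  | bdry (c x : OnePoint ℝ) (hc : IsCusp c (liftGL Γ)) (hx : x ≠ c) : BorelSerre

/-- At a boundary point on the line of the cusp `c = g ∞`, with foot `g x`, basic neighbourhoods are
the images under `g` of `{|Re z - x| < ε, Im z > 1/ε}` together with the boundary points of
the same line whose foot is `g x'` with `|x' - x| < ε`. In `ℍ` the topology is the usual one. -/
instance : TopologicalSpace (BorelSerre Γ) where
  IsOpen U := IsOpen (BorelSerre.inner ⁻¹' U) ∧
    ∀ (g : SL(2, ℝ)) (x : ℝ) (c p : OnePoint ℝ) (hc : IsCusp c (liftGL Γ)) (hp : p ≠ c),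
      c = (g : GL (Fin 2) ℝ) • OnePoint.infty → p = (g : GL (Fin 2) ℝ) • (x : OnePoint ℝ) →
      BorelSerre.bdry c p hc hp ∈ U → ∃ ε > (0 : ℝ),
        (∀ z : ℍ, |z.re - x| < ε → 1 / ε < z.im → BorelSerre.inner (g • z) ∈ U) ∧
        (∀ (x' : ℝ) (p' : OnePoint ℝ) (hp' : p' ≠ c), |x' - x| < ε →
          p' = (g : GL (Fin 2) ℝ) • (x' : OnePoint ℝ) → BorelSerre.bdry c p' hc hp' ∈ U)
  isOpen_univ := ⟨isOpen_univ, fun _ _ _ _ _ _ _ _ _ => ⟨1, one_pos, by simp, by simp⟩⟩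
  isOpen_inter U V hU hV := by
    refine ⟨hU.1.inter hV.1, fun g x c p hc hp hgc hgp hmem => ?_⟩
    obtain ⟨a, ha, ha1, ha2⟩ := hU.2 g x c p hc hp hgc hgp hmem.1
    obtain ⟨b, hb, hb1, hb2⟩ := hV.2 g x c p hc hp hgc hgp hmem.2
    refine ⟨min a b, lt_min ha hb, fun z h1 h2 => ⟨ha1 z ?_ ?_, hb1 z ?_ ?_⟩,
      fun x' p' hp' h1 h2 => ⟨ha2 x' p' hp' ?_ h2, hb2 x' p' hp' ?_ h2⟩⟩
    · exact h1.trans_le (min_le_left _ _)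
    · exact (one_div_le_one_div_of_le (lt_min ha hb) (min_le_left _ _)).trans_lt h2
    · exact h1.trans_le (min_le_right _ _)
    · exact (one_div_le_one_div_of_le (lt_min ha hb) (min_le_right _ _)).trans_lt h2
    · exact h1.trans_le (min_le_left _ _)
    · exact h1.trans_le (min_le_right _ _)
  isOpen_sUnion 𝒰 h𝒰 := by
    refine ⟨?_, fun g x c p hc hp hgc hgp hmem => ?_⟩
    · rw [Set.preimage_sUnion]
      exact isOpen_biUnion fun U hU => (h𝒰 U hU).1
    · obtain ⟨U, hU, hmem⟩ := hmem
      obtain ⟨a, ha, ha1, ha2⟩ := (h𝒰 U hU).2 g x c p hc hp hgc hgp hmem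
      exact ⟨a, ha, fun z h1 h2 => ⟨U, hU, ha1 z h1 h2⟩,
        fun x' p' hp' h1 h2 => ⟨U, hU, ha2 x' p' hp' h1 h2⟩⟩

/-- The space `L²_loc(ℍ_Γ)`: every point of `ℍ_Γ` has a neighbourhood on which `f` is square
integrable. The measure on `ℍ_Γ` is the hyperbolic measure on `ℍ`, and `ℍ_Γ ∖ ℍ` is a null set, so
that elements are given by functions on `ℍ` modulo null functions. -/
def L2loc : Submodule ℂ (ℍ →ₘ[volume] ℂ) where
  carrier := {f | ∀ p : BorelSerre Γ, ∃ U ∈ 𝓝 p,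
    MemLp f 2 (volume.restrict (BorelSerre.inner ⁻¹' U))}
  add_mem' {f g} hf hg p := by
    obtain ⟨U, hU, hfU⟩ := hf p
    obtain ⟨V, hV, hgV⟩ := hg p
    refine ⟨U ∩ V, Filter.inter_mem hU hV, ?_⟩
    have h1 := hfU.mono_measure (Measure.restrict_mono
      (Set.preimage_mono (Set.inter_subset_left : U ∩ V ⊆ U)) (le_refl (volume : Measure ℍ)))
    have h2 := hgV.mono_measure (Measure.restrict_mono
      (Set.preimage_mono (Set.inter_subset_right : U ∩ V ⊆ V)) (le_refl (volume : Measure ℍ)))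
    exact (memLp_congr_ae (ae_restrict_of_ae (AEEqFun.coeFn_add f g))).mpr (h1.add h2)
  zero_mem' p := by
    refine ⟨Set.univ, Filter.univ_mem, ?_⟩
    exact (memLp_congr_ae (ae_restrict_of_ae
      (AEEqFun.coeFn_zero (α := ℍ) (β := ℂ) (μ := volume)))).mpr MemLp.zero
  smul_mem' a f hf p := by
    obtain ⟨U, hU, hfU⟩ := hf p
    exact ⟨U, hU, (memLp_congr_ae (ae_restrict_of_ae (AEEqFun.coeFn_smul a f))).mpr
      (hfU.const_smul a)⟩

/-- The space `L²_q(Γ \ ℍ)` of all `f ∈ L²_loc(ℍ_Γ)` with `J_{q+1} f = 0`. -/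
def L2q (q : ℕ) : Submodule ℂ (ℍ →ₘ[volume] ℂ) := L2loc Γ ⊓ formsF Γ q

/-! ### Fundamental domains and generators -/

/-- A (complete) geodesic of the hyperbolic plane: a vertical line or a half circle
centred on the real axis. -/
def IsGeodesicLine (L : Set ℍ) : Prop :=
  (∃ a : ℝ, L = {z | z.re = a}) ∨
    ∃ a r : ℝ, 0 < r ∧ L = {z | (z.re - a) ^ 2 + z.im ^ 2 = r ^ 2}

/-- `D` is a closed fundamental domain of `Γ` with finitely many geodesic sides. -/
structure IsClosedFundamentalDomain (D : Set ℍ) : Prop where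
  isClosed : IsClosed D
  covers : ⋃ γ : Γ, γ • D = Set.univ
  disjoint : ∀ γ : Γ, γ ≠ 1 → Disjoint (interior D) (interior (γ • D))
  /-- every point of `ℍ` has a neighbourhood meeting only finitely many translates of `D` -/
  locallyFinite : LocallyFinite fun γ : Γ => γ • D
  /-- the boundary is a finite union of arcs (connected subsets) of geodesics -/
  sides : ∃ A : Set (Set ℍ), A.Finite ∧ frontier D = ⋃₀ A ∧
    ∀ s ∈ A, IsPreconnected s ∧ ∃ L, IsGeodesicLine L ∧ s ⊆ L

/-- A choice of a finite symmetric set of generators `S ∋ 1` of `Γ` and a closed fundamental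
domain `D` with finitely many geodesic sides. -/
structure DomainChoice where
  S : Set Γ
  finite : S.Finite
  one_mem : 1 ∈ S
  symm : ∀ s ∈ S, s⁻¹ ∈ S
  generates : Subgroup.closure S = ⊤
  D : Set ℍ
  isDomain : IsClosedFundamentalDomain Γ D

variable {Γ}

/-- The set `S^q D`, the union of all `s₁ ⋯ s_q D` with `s₁, …, s_q ∈ S`. -/
def DomainChoice.tile (c : DomainChoice Γ) (q : ℕ) : Set ℍ := (c.S ^ q : Set Γ) • c.D

/-!
Modulo `I ^ (q + 1)` the group ring `ℂ[Γ]` is spanned by the products of at most `q` generators. So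
for `f ∈ F_q` the values on any translate `γ D` are fixed linear combinations of the values on the
translates making up `S^q D`. This gives uniqueness, and it bounds the energy `∫ |f|² dμ` over
`γ D` by a constant times the energy over `S^q D`.

An element of `F_q` is invariant under `Γ_par`, and near a cusp the group generated by one parabolic
element translates a strip. Hence the energy near a boundary point of the Borel-Serre space, and the
energy over `S^q D`, are bounded by the energy over finitely many tiles, respectively over finitely
many compact pieces and strips: square integrability on `S^q D` is local square integrability. As
the bounds are uniform, different choices of `(S, D)` give equivalent norms, and `Γ(1)`, which
permutes the fundamental domains, acts continuously.

The constant function `1` has norm squared `μ(S^q D)`, which grows when a new generator is adjoined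
to `S`. If `χ : Γ → ℂ` is a nonzero homomorphism trivial on `Γ_par`, some `f ∈ F_1` satisfies
`γ f = f - χ(γ)`, and unitarity would force the inner product of `f - χ(γ)` with `1` to be that of
`f` with `1`, so `χ = 0`. Without such a `χ`, every element of `F_q` is `Γ`-invariant, and its
energy over a fundamental domain does not depend on the domain.
-/

open scoped ENNReal NNReal

/-! ### Higher invariants -/

section HigherInvariants

theorem asAlgebraHom_mapDomain {k G H W : Type*} [CommSemiring k] [Monoid G] [Monoid H]
    [AddCommMonoid W] [Module k W] (ρ : Representation k G W) (φ : H →* G)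
    (x : MonoidAlgebra k H) :
    ρ.asAlgebraHom (MonoidAlgebra.mapDomainRingHom k φ x) =
      Representation.asAlgebraHom (ρ.comp φ) x := by
  induction x using MonoidAlgebra.induction_linear with
  | zero => simp
  | add a b ha hb => simp only [map_add, ha, hb]
  | single g c => simp

variable {G : Type*} [Group G] {W : Type*} [AddCommGroup W] [Module ℂ W]
  (ρ : Representation ℂ G W) (P : Subgroup G)

theorem of_sub_one_mem_augIdeal (g : G) : MonoidAlgebra.of ℂ G g - 1 ∈ augIdeal G := by
  simp [augIdeal, RingHom.mem_ker]

theorem asAlgebraHom_apply_mem_of_mem_augIdeal {V : Submodule ℂ W} {w : W}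
    (h : ∀ g, ρ g w - w ∈ V) {x : MonoidAlgebra ℂ G} (hx : x ∈ augIdeal G) :
    ρ.asAlgebraHom x w ∈ V := by
  have sub_smul_mem (x : MonoidAlgebra ℂ G) :
      ρ.asAlgebraHom x w - MonoidAlgebra.lift ℂ ℂ G (1 : G →* ℂ) x • w ∈ V := by
    induction x using MonoidAlgebra.induction_linear with
    | zero => simp
    | add a b ha hb =>
      simpa only [map_add, LinearMap.add_apply, add_smul, add_sub_add_comm] using V.add_mem ha hb
    | single g c =>
      simpa only [Representation.asAlgebraHom_single, LinearMap.smul_apply,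
        MonoidAlgebra.lift_single, MonoidHom.one_apply, smul_eq_mul, mul_one, ← smul_sub] using
        V.smul_mem c (h g)
  have hx' : MonoidAlgebra.lift ℂ ℂ G (1 : G →* ℂ) x = 0 := hx
  simpa [hx'] using sub_smul_mem x

theorem forall_mem_augIdeal_asAlgebraHom_eq_zero_iff {w : W} :
    (∀ x ∈ augIdeal G, ρ.asAlgebraHom x w = 0) ↔ ∀ g, ρ g w = w := by
  refine ⟨fun h g => ?_, fun h x hx => ?_⟩
  · simpa [sub_eq_zero] using h _ (of_sub_one_mem_augIdeal g)
  · simpa using asAlgebraHom_apply_mem_of_mem_augIdeal ρ (V := ⊥) (fun g => by simp [h g]) hx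

theorem forall_mem_relAugIdeal_asAlgebraHom_eq_zero_iff {w : W} :
    (∀ x ∈ relAugIdeal P, ρ.asAlgebraHom x w = 0) ↔ ∀ p ∈ P, ρ p w = w := by
  have restrict_iff := forall_mem_augIdeal_asAlgebraHom_eq_zero_iff (ρ.comp P.subtype) (w := w)
  rw [← Subtype.forall (p := fun p : G => p ∈ P) (q := fun p => ρ p w = w)]
  refine Iff.trans ⟨fun h x hx => ?_, fun h x hx => ?_⟩ restrict_iff
  · rw [← asAlgebraHom_mapDomain]
    exact h _ (Ideal.subset_span ⟨x, hx, rfl⟩)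
  · induction hx using Submodule.span_induction with
    | mem x hx =>
      obtain ⟨y, hy, rfl⟩ := hx
      rw [asAlgebraHom_mapDomain, h y hy]
    | zero => simp
    | add x y _ _ hx hy => simp [hx, hy]
    | smul a x _ hx => simp [hx]

theorem mem_higherInvariants_iff {q : ℕ} {w : W} :
    w ∈ higherInvariants ρ P q ↔
      (∀ x ∈ augIdeal G ^ (q + 1), ρ.asAlgebraHom x w = 0) ∧ ∀ p ∈ P, ρ p w = w := by
  rw [← forall_mem_relAugIdeal_asAlgebraHom_eq_zero_iff]
  simp only [higherInvariants, Submodule.mem_iInf, LinearMap.mem_ker]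
  refine ⟨fun h => ⟨fun x hx => h x (Ideal.mem_sup_left hx),
    fun x hx => h x (Ideal.mem_sup_right hx)⟩, fun ⟨haug, hrel⟩ x hx => ?_⟩
  obtain ⟨y, hy, z, hz, rfl⟩ := Submodule.mem_sup.mp hx
  rw [map_add, LinearMap.add_apply, haug y hy, hrel z hz, add_zero]

variable {P} in
theorem apply_eq_of_mem_higherInvariants {q : ℕ} {w : W} (hw : w ∈ higherInvariants ρ P q) {p : G}
    (hp : p ∈ P) : ρ p w = w :=
  ((mem_higherInvariants_iff ρ P).mp hw).2 p hp

theorem mem_higherInvariants_zero_iff {w : W} :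
    w ∈ higherInvariants ρ P 0 ↔ ∀ g, ρ g w = w := by
  rw [mem_higherInvariants_iff, zero_add, Submodule.pow_one,
    forall_mem_augIdeal_asAlgebraHom_eq_zero_iff]
  exact and_iff_left_of_imp fun h p _ => h p

theorem mem_higherInvariants_succ_iff [P.Normal] {q : ℕ} {w : W} :
    w ∈ higherInvariants ρ P (q + 1) ↔
      (∀ g, ρ g w - w ∈ higherInvariants ρ P q) ∧ ∀ p ∈ P, ρ p w = w := by
  rw [mem_higherInvariants_iff]
  refine and_congr_left fun hP => ⟨fun h g => ?_, fun h x hx => ?_⟩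
  · rw [mem_higherInvariants_iff]
    refine ⟨fun x hx => ?_, fun p hp => ?_⟩
    · have hmem : x * (MonoidAlgebra.of ℂ G g - 1) ∈ augIdeal G ^ (q + 1 + 1) := by
        rw [Submodule.pow_succ]
        exact Ideal.mul_mem_mul hx (of_sub_one_mem_augIdeal g)
      simpa using h _ hmem
    · have hconj : ρ p (ρ g w) = ρ g (ρ (g⁻¹ * p * g) w) := by
        simp only [← Module.End.mul_apply, ← map_mul]
        group
      rw [map_sub, hconj, hP p hp, hP _ (by simpa using ‹P.Normal›.conj_mem p hp g⁻¹)]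
  · rw [Submodule.pow_succ] at hx
    refine Submodule.smul_induction_on hx (fun a ha b hb => ?_) (fun a b ha hb => by simp [ha, hb])
    have hbw := asAlgebraHom_apply_mem_of_mem_augIdeal ρ h hb
    simpa using ((mem_higherInvariants_iff ρ P).mp hbw).1 a ha

theorem higherInvariants_mono [P.Normal] : Monotone (higherInvariants ρ P) := by
  refine monotone_nat_of_le_succ fun q => ?_
  induction q with
  | zero =>
    intro w hw
    rw [mem_higherInvariants_zero_iff] at hw
    exact (mem_higherInvariants_succ_iff ρ P).mpr ⟨fun g => by simp [hw g], fun p _ => hw p⟩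
  | succ q ih =>
    intro w hw
    rw [mem_higherInvariants_succ_iff] at hw ⊢
    exact ⟨fun g => ih (hw.1 g), hw.2⟩

/-- If all increments `ρ g w - w` are invariant, then `g ↦ l (ρ g w - w)` is a homomorphism to the
additive group of scalars for every linear form `l`. It measures how far the second order
invariant `w` is from being invariant. -/
def incrementHom {k G W : Type*} [CommRing k] [Group G] [AddCommGroup W] [Module k W]
    (ρ : Representation k G W) (w : W) (hw : ∀ g g', ρ g' (ρ g w - w) = ρ g w - w)
    (l : Module.Dual k W) : G →* Multiplicative k where
  toFun g := .ofAdd (l (ρ g w - w))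
  map_one' := by simp
  map_mul' g g' := by
    have cocycle : ρ (g * g') w - w = (ρ g w - w) + (ρ g' w - w) := by
      rw [← hw g' g, map_mul, Module.End.mul_apply, map_sub]
      abel
    rw [cocycle, map_add, ofAdd_add]

theorem higherInvariants_eq_higherInvariants_zero [P.Normal]
    (h : ∀ χ : G →* Multiplicative ℂ, (∀ p ∈ P, χ p = 1) → χ = 1) (q : ℕ) :
    higherInvariants ρ P q = higherInvariants ρ P 0 := by
  refine le_antisymm ?_ (higherInvariants_mono ρ P (Nat.zero_le q))
  induction q with
  | zero => exact le_rfl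
  | succ q ih =>
    intro w hw
    obtain ⟨hsub, hP⟩ := (mem_higherInvariants_succ_iff ρ P).mp hw
    have hinv (g g' : G) : ρ g' (ρ g w - w) = ρ g w - w :=
      (mem_higherInvariants_zero_iff ρ P).mp (ih (hsub g)) g'
    rw [mem_higherInvariants_zero_iff]
    refine fun g => sub_eq_zero.mp ((Module.forall_dual_apply_eq_zero_iff ℂ _).mp fun l => ?_)
    have hχ := h (incrementHom ρ w hinv l) fun p hp => by simp [incrementHom, hP p hp]
    exact congrArg Multiplicative.toAdd (DFunLike.congr_fun hχ g)

theorem apply_mem_higherInvariants_of_normal {H : Type*} [Group H] {Γ : Subgroup H} [Γ.Normal]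
    {P : Subgroup Γ} [P.Normal] (ρ : Representation ℂ H W)
    (hP : ∀ (h : H), ∀ p ∈ P, MulAut.conjNormal h p ∈ P) (h : H) {q : ℕ} {w : W}
    (hw : w ∈ higherInvariants (ρ.comp Γ.subtype) P q) :
    ρ h w ∈ higherInvariants (ρ.comp Γ.subtype) P q := by
  have hconj (γ : Γ) (w : W) : ρ γ (ρ h w) = ρ h (ρ (MulAut.conjNormal h⁻¹ γ : Γ) w) := by
    rw [← Module.End.mul_apply, ← Module.End.mul_apply, ← map_mul, ← map_mul,
      MulAut.conjNormal_apply]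
    group
  induction q generalizing w with
  | zero =>
    rw [mem_higherInvariants_zero_iff] at hw ⊢
    exact fun γ => (hconj γ w).trans (congrArg (ρ h) (hw (MulAut.conjNormal h⁻¹ γ)))
  | succ q ih =>
    rw [mem_higherInvariants_succ_iff] at hw ⊢
    refine ⟨fun γ => ?_, fun p hp => (hconj p w).trans (congrArg (ρ h) (hw.2 _ (hP _ p hp)))⟩
    change ρ γ (ρ h w) - ρ h w ∈ _
    rw [hconj, ← map_sub]
    exact ih (hw.1 (MulAut.conjNormal h⁻¹ γ))

theorem exists_mem_span_pow_of_sub_mem_augIdeal_pow {S : Set G} (h1 : 1 ∈ S)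
    (hS : Submonoid.closure S = ⊤) (q : ℕ) (g : G) :
    ∃ a ∈ Submodule.span ℂ (MonoidAlgebra.of ℂ G '' S) ^ q,
      MonoidAlgebra.of ℂ G g - a ∈ augIdeal G ^ (q + 1) := by
  induction q generalizing g with
  | zero =>
    refine ⟨1, by rw [pow_zero]; exact Submodule.one_le.mp le_rfl, ?_⟩
    simpa [Submodule.pow_one] using of_sub_one_mem_augIdeal g
  | succ q ih =>
    have hone : (1 : MonoidAlgebra ℂ G) ∈ Submodule.span ℂ (MonoidAlgebra.of ℂ G '' S) :=
      Submodule.subset_span ⟨1, h1, map_one _⟩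
    have hg : g ∈ Submonoid.closure S := hS ▸ Submonoid.mem_top g
    induction hg using Submonoid.closure_induction_right with
    | one =>
      refine ⟨1, by simpa using Submodule.pow_mem_pow _ hone (q + 1), ?_⟩
      rw [map_one, sub_self]
      exact zero_mem _
    | mul_right g _ s hs ihg =>
      obtain ⟨a, ha, hga⟩ := ih g
      obtain ⟨b, hb, hgb⟩ := ihg
      refine ⟨a * (MonoidAlgebra.of ℂ G s - 1) + b, add_mem ?_ hb, ?_⟩
      · rw [pow_succ]
        exact Submodule.mul_mem_mul ha
          (sub_mem (Submodule.subset_span (Set.mem_image_of_mem _ hs)) hone)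
      · have split : MonoidAlgebra.of ℂ G (g * s) - (a * (MonoidAlgebra.of ℂ G s - 1) + b) =
            (MonoidAlgebra.of ℂ G g - a) * (MonoidAlgebra.of ℂ G s - 1) +
              (MonoidAlgebra.of ℂ G g - b) := by
          rw [map_mul]
          noncomm_ring
        rw [split]
        refine add_mem ?_ hgb
        rw [Submodule.pow_succ]
        exact Ideal.mul_mem_mul hga (of_sub_one_mem_augIdeal s)

theorem exists_mem_span_pow_apply_eq {S : Set G} (h1 : 1 ∈ S) (hS : Submonoid.closure S = ⊤)
    (q : ℕ) (g : G) : ∃ a ∈ Submodule.span ℂ (MonoidAlgebra.of ℂ G '' (S ^ q)),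
      ∀ w ∈ higherInvariants ρ P q, ρ g w = ρ.asAlgebraHom a w := by
  obtain ⟨a, ha, hga⟩ := exists_mem_span_pow_of_sub_mem_augIdeal_pow h1 hS q g
  rw [Submodule.span_pow, ← Set.image_pow] at ha
  refine ⟨a, ha, fun w hw => ?_⟩
  simpa [sub_eq_zero] using ((mem_higherInvariants_iff ρ P).mp hw).1 _ hga

end HigherInvariants

/-! ### Square integrals over subsets -/

section Energy

variable {α E : Type*} [MeasurableSpace α] {μ : Measure α} [NormedAddCommGroup E]

/-- The square of the `L²`-seminorm of `f` on `A`, as an extended real number so that it is additive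
in `A` for every measurable `f`. -/
noncomputable def energy (A : Set α) (f : α →ₘ[μ] E) : ℝ≥0∞ :=
  ∫⁻ x in A, ‖f x‖ₑ ^ (2 : ℝ) ∂μ

theorem memLp_two_restrict_iff {A : Set α} {f : α →ₘ[μ] E} :
    MemLp f 2 (μ.restrict A) ↔ energy A f < ∞ := by
  rw [MemLp, and_iff_right f.aestronglyMeasurable.restrict,
    eLpNorm_lt_top_iff_lintegral_rpow_enorm_lt_top two_ne_zero ENNReal.ofNat_ne_top,
    ENNReal.toReal_ofNat, energy]

theorem eLpNorm_two_restrict_sq (A : Set α) (f : α →ₘ[μ] E) :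
    eLpNorm f 2 (μ.restrict A) ^ 2 = energy A f := by
  rw [eLpNorm_eq_lintegral_rpow_enorm_toReal two_ne_zero ENNReal.ofNat_ne_top, ENNReal.toReal_ofNat,
    ← ENNReal.rpow_natCast, ← ENNReal.rpow_mul]
  simp [energy]

theorem energy_mono {A B : Set α} (h : A ⊆ B) (f : α →ₘ[μ] E) : energy A f ≤ energy B f :=
  lintegral_mono_set h

theorem energy_iUnion_le {ι : Type*} [Countable ι] (A : ι → Set α) (f : α →ₘ[μ] E) :
    energy (⋃ i, A i) f ≤ ∑' i, energy (A i) f :=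
  lintegral_iUnion_le _ _

theorem energy_biUnion_le {ι : Type*} (F : Finset ι) (A : ι → Set α) (f : α →ₘ[μ] E) :
    energy (⋃ i ∈ F, A i) f ≤ ∑ i ∈ F, energy (A i) f := by
  have hsub : ⋃ i ∈ F, A i = ⋃ i : F, A i := (Set.iUnion_subtype (· ∈ F) fun i => A i.1).symm
  rw [← F.tsum_subtype, hsub]
  exact energy_iUnion_le _ _

theorem energy_union_lt_top {A B : Set α} {f : α →ₘ[μ] E} (hA : energy A f < ∞)
    (hB : energy B f < ∞) : energy (A ∪ B) f < ∞ :=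
  (lintegral_union_le _ A B).trans_lt (ENNReal.add_lt_top.mpr ⟨hA, hB⟩)

theorem energy_biUnion_lt_top {ι : Type*} {F : Set ι} (hF : F.Finite) {A : ι → Set α}
    {f : α →ₘ[μ] E} (h : ∀ i ∈ F, energy (A i) f < ∞) : energy (⋃ i ∈ F, A i) f < ∞ := by
  lift F to Finset ι using hF
  exact (energy_biUnion_le F A f).trans_lt (ENNReal.sum_lt_top.mpr h)

theorem energy_add_le (A : Set α) (f g : α →ₘ[μ] E) :
    energy A (f + g) ≤ 2 * (energy A f + energy A g) := by
  calc energy A (f + g)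
      ≤ ∫⁻ x in A, 2 * (‖f x‖ₑ ^ (2 : ℝ) + ‖g x‖ₑ ^ (2 : ℝ)) ∂μ := by
        refine lintegral_mono_ae ?_
        filter_upwards [ae_restrict_of_ae (AEEqFun.coeFn_add f g)] with x hx
        have hpow := ENNReal.rpow_add_le_mul_rpow_add_rpow ‖f x‖ₑ ‖g x‖ₑ one_le_two
        norm_num at hpow
        rw [hx, Pi.add_apply]
        calc ‖f x + g x‖ₑ ^ (2 : ℝ) ≤ (‖f x‖ₑ + ‖g x‖ₑ) ^ (2 : ℝ) := by
              gcongr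
              exact enorm_add_le _ _
          _ ≤ _ := by simpa using hpow
    _ = 2 * (energy A f + energy A g) := by
        rw [lintegral_const_mul' _ _ ENNReal.ofNat_ne_top,
          lintegral_add_left' (f.aestronglyMeasurable.restrict.enorm.pow_const _), energy, energy]

theorem energy_const_smul {𝕜 : Type*} [NormedField 𝕜] [NormedSpace 𝕜 E] (A : Set α) (c : 𝕜)
    (f : α →ₘ[μ] E) : energy A (c • f) = ‖c‖ₑ ^ (2 : ℝ) * energy A f := by
  rw [energy, energy, ← lintegral_const_mul' _ _ (by simp)]
  refine lintegral_congr_ae (ae_restrict_of_ae ?_)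
  filter_upwards [AEEqFun.coeFn_smul c f] with x hx
  rw [hx, Pi.smul_apply, enorm_smul, ENNReal.mul_rpow_of_nonneg _ _ zero_le_two]

theorem energy_eq_zero_iff {A : Set α} {f : α →ₘ[μ] E} :
    energy A f = 0 ↔ f =ᵐ[μ.restrict A] 0 := by
  rw [energy, lintegral_eq_zero_iff' (f.aestronglyMeasurable.restrict.enorm.pow_const _)]
  exact Filter.eventually_congr (Filter.Eventually.of_forall fun x => by simp)

/-- The functions in `V` are controlled on `A` by their restriction to `B`: restriction to `A` is
`L²`-continuous with respect to restriction to `B`. -/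
def EnergyDominated (V : Set (α →ₘ[μ] E)) (A B : Set α) : Prop :=
  ∃ C : ℝ≥0, ∀ f ∈ V, energy A f ≤ C * energy B f

namespace EnergyDominated

variable {V : Set (α →ₘ[μ] E)} {A B C : Set α}

theorem of_forall_le (h : ∀ f ∈ V, energy A f ≤ energy B f) : EnergyDominated V A B :=
  ⟨1, fun f hf => by simpa using h f hf⟩

theorem trans (hAB : EnergyDominated V A B) (hBC : EnergyDominated V B C) :
    EnergyDominated V A C := by
  obtain ⟨a, ha⟩ := hAB
  obtain ⟨b, hb⟩ := hBC
  refine ⟨a * b, fun f hf => (ha f hf).trans ?_⟩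
  rw [ENNReal.coe_mul, mul_assoc]
  gcongr
  exact hb f hf

theorem biUnion {ι : Type*} {F : Set ι} (hF : F.Finite) {A : ι → Set α}
    (h : ∀ i ∈ F, EnergyDominated V (A i) B) : EnergyDominated V (⋃ i ∈ F, A i) B := by
  choose! a ha using h
  lift F to Finset ι using hF
  refine ⟨∑ i ∈ F, a i, fun f hf => (energy_biUnion_le F A f).trans ?_⟩
  push_cast
  rw [Finset.sum_mul]
  exact Finset.sum_le_sum fun i hi => ha i hi f hf

theorem energy_lt_top (h : EnergyDominated V A B) {f : α →ₘ[μ] E} (hf : f ∈ V)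
    (hB : energy B f < ∞) : energy A f < ∞ := by
  obtain ⟨a, ha⟩ := h
  exact (ha f hf).trans_lt (ENNReal.mul_lt_top ENNReal.coe_lt_top hB)

end EnergyDominated

section Invariance

variable {G : Type*} [Group G] [MulAction G α] [MeasurableConstSMul G α]
  [SMulInvariantMeasure G α μ]

theorem energy_domMulAct_smul (g : G) (A : Set α) (f : α →ₘ[μ] E) :
    energy A (DomMulAct.mk g • f) = energy (g • A) f := by
  have hint := (measurePreserving_smul g μ).setLIntegral_comp_preimage_emb
    (measurableEmbedding_const_smul g) (fun x => ‖f x‖ₑ ^ (2 : ℝ)) (g • A)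
  rw [Set.preimage_smul, inv_smul_smul] at hint
  rw [energy, energy, ← hint]
  refine lintegral_congr_ae (ae_restrict_of_ae ?_)
  filter_upwards [DomMulAct.smul_aeeqFun_aeeq (DomMulAct.mk g) f] with x hx
  rw [hx]
  rfl

theorem energy_le_of_subset_iUnion_smul [Countable G] {A B : Set α} {f : α →ₘ[μ] E}
    (hf : ∀ g : G, DomMulAct.mk g • f = f) (hA : MeasurableSet A)
    (hdisj : ∀ g : G, g ≠ 1 → AEDisjoint μ A (g • A)) (hB : MeasurableSet B)
    (hsub : A ⊆ ⋃ g : G, g • B) : energy A f ≤ energy B f := by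
  have hmeas (g : G) : NullMeasurableSet (g⁻¹ • A ∩ B) μ :=
    ((hA.const_smul _).inter hB).nullMeasurableSet
  have hpairwise : Pairwise (Function.onFun (AEDisjoint μ) fun g : G => g⁻¹ • A ∩ B) := by
    intro g g' hg
    refine AEDisjoint.mono ?_ Set.inter_subset_left Set.inter_subset_left
    rw [AEDisjoint, ← measure_smul μ g, Set.smul_set_inter, smul_inv_smul, smul_smul]
    exact hdisj _ (by rwa [Ne, mul_inv_eq_one])
  calc energy A f ≤ energy (⋃ g : G, A ∩ g • B) f :=
        energy_mono (by rw [← Set.inter_iUnion]; exact Set.subset_inter le_rfl hsub) f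
    _ ≤ ∑' g : G, energy (A ∩ g • B) f := energy_iUnion_le _ _
    _ = ∑' g : G, energy (g⁻¹ • A ∩ B) f := by
        refine tsum_congr fun g => ?_
        conv_rhs => rw [← hf g, energy_domMulAct_smul, Set.smul_set_inter, smul_inv_smul]
    _ = energy (⋃ g : G, g⁻¹ • A ∩ B) f := (lintegral_iUnion₀ hmeas hpairwise _).symm
    _ ≤ energy B f := energy_mono (Set.iUnion_subset fun g => Set.inter_subset_right) f

end Invariance

end Energy

/-! ### The modular group -/

section ModularGroup

/-- The class of `z ↦ z + 1` in `PSL(2, ℤ)`, which generates the stabilizer of the cusp `∞`. -/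
def pslT : PSL(2, ℤ) := (ModularGroup.T : SL(2, ℤ))

theorem pslT_zpow (k : ℤ) : pslT ^ k = ((ModularGroup.T ^ k : SL(2, ℤ)) : PSL(2, ℤ)) := rfl

theorem re_pslT_zpow_smul (k : ℤ) (z : ℍ) : (pslT ^ k • z).re = z.re + k := by
  rw [pslT_zpow, PSL2Z_mk_smul, ModularGroup.re_T_zpow_smul]

theorem im_pslT_zpow_smul (k : ℤ) (z : ℍ) : (pslT ^ k • z).im = z.im := by
  rw [pslT_zpow, PSL2Z_mk_smul, ModularGroup.im_T_zpow_smul]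

theorem pslT_zpow_injective : Function.Injective fun k : ℤ => pslT ^ k := by
  intro k l hkl
  have hre := congrArg (fun γ : PSL(2, ℤ) => (γ • UpperHalfPlane.I).re) hkl
  simpa [re_pslT_zpow_smul] using hre

/-- The standard horoball at the cusp `∞`. The level `1` is high enough for its translates under
`PSL(2, ℤ)` to be pairwise equal or disjoint. -/
def horoball : Set ℍ := {z | 1 < z.im}

/-- The part of the horoball of level `Y` at `∞` that lies over the set `I` of real numbers. -/
def cuspStrip (I : Set ℝ) (Y : ℝ) : Set ℍ := {z | z.re ∈ I ∧ Y < z.im}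

theorem isOpen_horoball : IsOpen horoball :=
  isOpen_lt continuous_const continuous_im

theorem horoball_nonempty : horoball.Nonempty :=
  ⟨⟨⟨0, 2⟩, two_pos⟩, show (1 : ℝ) < 2 from one_lt_two⟩

theorem isPreconnected_horoball : IsPreconnected horoball := by
  rw [← isEmbedding_coe.isInducing.isPreconnected_image]
  convert (convex_halfSpace_im_gt 1).isPreconnected
  ext w
  refine ⟨fun ⟨_, hz, hzw⟩ => hzw ▸ hz, fun hw => ⟨⟨w, zero_lt_one.trans hw⟩, hw, rfl⟩⟩

theorem measurableSet_cuspStrip {I : Set ℝ} (hI : MeasurableSet I) (Y : ℝ) :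
    MeasurableSet (cuspStrip I Y) :=
  (continuous_re.measurable hI).inter (isOpen_lt continuous_const continuous_im).measurableSet

theorem cuspStrip_subset_horoball (I : Set ℝ) : cuspStrip I 1 ⊆ horoball := fun _ hz => hz.2

theorem exists_mem_smul_truncatedFundamentalDomain_or_horoball (z : ℍ) : ∃ g : PSL(2, ℤ),
    z ∈ g • ModularGroup.truncatedFundamentalDomain 1 ∨ z ∈ g • horoball := by
  obtain ⟨g, hg⟩ := ModularGroup.exists_smul_mem_fd z
  refine ⟨(g : PSL(2, ℤ))⁻¹, ?_⟩
  simp only [Set.mem_smul_set_iff_inv_smul_mem, inv_inv, PSL2Z_mk_smul]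
  exact (le_or_gt (g • z).im 1).imp (fun h => ⟨hg, h⟩) id

theorem exists_pslT_zpow_smul_mem_truncatedFundamentalDomain {z : ℍ} (hz : z.im = 1) :
    ∃ k : ℤ, pslT ^ k • z ∈ ModularGroup.truncatedFundamentalDomain 1 := by
  refine ⟨-round z.re, ⟨?_, ?_⟩, by rw [im_pslT_zpow_smul, hz]⟩
  · rw [Complex.normSq_apply, coe_re, coe_im, im_pslT_zpow_smul, hz]
    linarith [mul_self_nonneg (pslT ^ (-round z.re) • z).re]
  · rw [re_pslT_zpow_smul, Int.cast_neg, ← sub_eq_add_neg]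
    exact abs_sub_round _

theorem exists_coe_eq_pslT_zpow_of_lower_left_eq_zero {g : SL(2, ℤ)} (h : g 1 0 = 0) :
    ∃ k : ℤ, (g : PSL(2, ℤ)) = pslT ^ k := by
  have hdet : g 0 0 * g 1 1 = 1 := by
    have := Matrix.det_fin_two (g : Matrix (Fin 2) (Fin 2) ℤ)
    rwa [g.det_coe, h, mul_zero, sub_zero, eq_comm] at this
  have eq_T_zpow {g : SL(2, ℤ)} (h0 : g 1 0 = 0) (h1 : g 0 0 = 1) (h2 : g 1 1 = 1) :
      g = ModularGroup.T ^ (g 0 1) := by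
    ext i j
    rw [ModularGroup.coe_T_zpow]
    fin_cases i <;> fin_cases j <;> simp [h0, h1, h2]
  rcases Int.eq_one_or_neg_one_of_mul_eq_one' hdet with ⟨h1, h2⟩ | ⟨h1, h2⟩
  · exact ⟨g 0 1, by rw [pslT_zpow, ← eq_T_zpow h h1 h2]⟩
  · refine ⟨(-g) 0 1, ?_⟩
    rw [pslT_zpow, ← eq_T_zpow (by simp [h]) (by simp [h1]) (by simp [h2]), QuotientGroup.eq,
      Matrix.SpecialLinearGroup.mem_center_iff, show g⁻¹ * -g = -1 by simp]
    refine ⟨-1, by simp, ?_⟩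
    ext i j
    fin_cases i <;> fin_cases j <;> simp

theorem lower_left_eq_zero_of_mem_horoball {g : SL(2, ℤ)} {z : ℍ} (hz : z ∈ horoball)
    (hgz : g • z ∈ horoball) : g 1 0 = 0 := by
  by_contra hc
  have hz' : 1 < z.im := hz
  have hgz' : 1 < (g • z).im := hgz
  rw [ModularGroup.im_smul_eq_div_normSq, lt_div_iff₀ (normSq_denom_pos _ z.im_ne_zero),
    one_mul] at hgz'
  have hdenom := c_mul_im_sq_le_normSq_denom (Matrix.SpecialLinearGroup.mapGL ℝ g) z
  have hc2 : (1 : ℝ) ≤ (Matrix.SpecialLinearGroup.mapGL ℝ g) 1 0 ^ 2 := by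
    have : (1 : ℤ) ≤ g 1 0 ^ 2 := Int.add_one_le_iff.mpr (sq_pos_of_ne_zero hc)
    simpa using (by exact_mod_cast this : (1 : ℝ) ≤ ((g 1 0 : ℤ) : ℝ) ^ 2)
  have hlt := hdenom.trans_lt hgz'
  rw [mul_pow] at hlt
  nlinarith [mul_le_mul_of_nonneg_right hc2 (sq_nonneg z.im)]

theorem exists_eq_pslT_zpow_of_mem_horoball {γ : PSL(2, ℤ)} {z : ℍ} (hz : z ∈ horoball)
    (hγ : γ • z ∈ horoball) : ∃ k : ℤ, γ = pslT ^ k := by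
  induction γ using QuotientGroup.induction_on with
  | H g =>
    exact exists_coe_eq_pslT_zpow_of_lower_left_eq_zero (lower_left_eq_zero_of_mem_horoball hz hγ)

theorem pslT_zpow_smul_horoball (k : ℤ) : pslT ^ k • horoball = horoball := by
  ext z
  rw [Set.mem_smul_set_iff_inv_smul_mem, ← zpow_neg, horoball, Set.mem_ofPred_eq,
    Set.mem_ofPred_eq, im_pslT_zpow_smul]

theorem smul_horoball_eq_of_inter_nonempty {g h : PSL(2, ℤ)}
    (H : (g • horoball ∩ h • horoball).Nonempty) : g • horoball = h • horoball := by
  obtain ⟨z, hg, hh⟩ := H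
  rw [Set.mem_smul_set_iff_inv_smul_mem] at hg hh
  obtain ⟨k, hk⟩ := exists_eq_pslT_zpow_of_mem_horoball (γ := h⁻¹ * g) hg
    (by rwa [mul_smul, smul_inv_smul])
  rw [inv_mul_eq_iff_eq_mul.mp hk, mul_smul, pslT_zpow_smul_horoball]

theorem disjoint_smul_cuspStrip_ball (g : PSL(2, ℤ)) (x : ℝ) {γ : PSL(2, ℤ)} (hγ : γ ≠ 1) :
    Disjoint (g • cuspStrip (Metric.ball x (1 / 2)) 1)
      (γ • g • cuspStrip (Metric.ball x (1 / 2)) 1) := by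
  rw [Set.disjoint_left]
  rintro _ ⟨z, hz, rfl⟩ ⟨_, ⟨w, hw, rfl⟩, hγw⟩
  have hconj : (g⁻¹ * γ * g) • w = z := by
    rw [mul_smul, mul_smul, inv_smul_eq_iff]
    exact hγw
  obtain ⟨k, hk⟩ := exists_eq_pslT_zpow_of_mem_horoball (γ := g⁻¹ * γ * g) hw.2 (hconj ▸ hz.2)
  have hre := re_pslT_zpow_smul k w
  rw [← hk, hconj] at hre
  have hzx := abs_lt.mp (Metric.mem_ball.mp hz.1)
  have hwx := abs_lt.mp (Metric.mem_ball.mp hw.1)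
  have hk0 : k = 0 := by
    have hlt : (k : ℝ) < 1 := by linarith
    have hgt : (-1 : ℝ) < k := by linarith
    norm_cast at hlt hgt
    lia
  rw [hk0, zpow_zero] at hk
  exact hγ (by simpa using conj_eq_one_iff.mp (show g⁻¹ * γ * g⁻¹⁻¹ = 1 by rwa [inv_inv]))

instance : Countable SL(2, ℤ) :=
  have : Countable (Matrix (Fin 2) (Fin 2) ℤ) := inferInstanceAs (Countable (Fin 2 → Fin 2 → ℤ))
  Subtype.countable

instance : Countable PSL(2, ℤ) := Quotient.countable

instance : MeasurableConstSMul PSL(2, ℤ) ℍ := ContinuousConstSMul.toMeasurableConstSMul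

theorem energy_translation (γ : PSL(2, ℤ)) (A : Set ℍ) (f : ℍ →ₘ[volume] ℂ) :
    energy A (translation γ f) = energy (γ⁻¹ • A) f :=
  energy_domMulAct_smul γ⁻¹ A f

end ModularGroup

/-! ### Parabolic elements -/

section Parabolic

theorem mapGL_apply_eq_intCast (g : SL(2, ℤ)) (i j : Fin 2) :
    (Matrix.SpecialLinearGroup.mapGL ℝ g) i j = ((g i j : ℤ) : ℝ) := by
  simp

theorem isParabolic_mapGL_conj_T_zpow (h : SL(2, ℤ)) {k : ℤ} (hk : k ≠ 0) :
    (Matrix.SpecialLinearGroup.mapGL ℝ (h * ModularGroup.T ^ k * h⁻¹)).IsParabolic := by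
  rw [map_mul, map_mul, map_inv, Matrix.GeneralLinearGroup.isParabolic_conj_iff,
    Matrix.GeneralLinearGroup.isParabolic_iff_of_upperTriangular]
  · simp only [mapGL_apply_eq_intCast, ModularGroup.coe_T_zpow]
    simp [hk]
  · rw [mapGL_apply_eq_intCast, ModularGroup.coe_T_zpow]
    simp

variable {Γ : Subgroup PSL(2, ℤ)}

theorem mem_parSubgroup_of_eq_conj_pslT_zpow {h : PSL(2, ℤ)} {k : ℤ} {γ : Γ}
    (hγ : (γ : PSL(2, ℤ)) = h * pslT ^ k * h⁻¹) : γ ∈ parSubgroup Γ := by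
  rcases eq_or_ne k 0 with rfl | hk
  · have : γ = 1 := Subtype.ext (by simpa using hγ)
    exact this ▸ one_mem _
  · induction h using QuotientGroup.induction_on with
    | H h =>
      exact Subgroup.subset_closure ⟨h * ModularGroup.T ^ k * h⁻¹, hγ.symm,
        isParabolic_mapGL_conj_T_zpow h hk⟩

theorem mem_parSubgroup_of_smul_mem_horoball {γ : Γ} {g : PSL(2, ℤ)} {z : ℍ}
    (hz : z ∈ g • horoball) (hγz : γ • z ∈ g • horoball) : γ ∈ parSubgroup Γ := by
  rw [Set.mem_smul_set_iff_inv_smul_mem] at hz hγz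
  have hconj : (g⁻¹ * γ * g) • g⁻¹ • z = g⁻¹ • (γ : PSL(2, ℤ)) • z := by
    simp only [smul_smul, mul_inv_cancel_right]
  obtain ⟨k, hk⟩ := exists_eq_pslT_zpow_of_mem_horoball hz (hconj ▸ hγz)
  refine mem_parSubgroup_of_eq_conj_pslT_zpow (h := g) (k := k) ?_
  rw [← hk]
  group

variable [Γ.Normal]

theorem conjNormal_mem_parSubgroup (g : PSL(2, ℤ)) {p : Γ} (hp : p ∈ parSubgroup Γ) :
    MulAut.conjNormal g p ∈ parSubgroup Γ := by
  induction hp using Subgroup.closure_induction with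
  | one => simp only [map_one, one_mem]
  | mul p p' _ _ hp hp' => simpa only [map_mul] using mul_mem hp hp'
  | inv p _ hp => simpa only [map_inv] using inv_mem hp
  | mem p hp =>
    obtain ⟨a, ha, hpar⟩ := hp
    induction g using QuotientGroup.induction_on with
    | H g =>
      refine Subgroup.subset_closure ⟨g * a * g⁻¹, ?_, ?_⟩
      · rw [MulAut.conjNormal_apply, ← ha]
        rfl
      · rwa [map_mul, map_mul, map_inv, Matrix.GeneralLinearGroup.isParabolic_conj_iff]

instance : (parSubgroup Γ).Normal where
  conj_mem p hp g := by
    have := conjNormal_mem_parSubgroup (g : PSL(2, ℤ)) hp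
    rwa [MulAut.conjNormal_val] at this

theorem conj_pslT_zpow_index_mul_mem (h : PSL(2, ℤ)) (k : ℤ) :
    h * pslT ^ (Γ.index * k) * h⁻¹ ∈ Γ := by
  refine ‹Γ.Normal›.conj_mem _ ?_ h
  rw [zpow_mul, zpow_natCast]
  exact zpow_mem (Γ.pow_index_mem pslT) k

variable (Γ) in
/-- The element `h T ^ (N k) h⁻¹` of `Γ_par`, where `N` is the index of `Γ`. It fixes the cusp
`h ∞`, at which it is the translation by `N k`. -/
noncomputable def cuspTranslation (h : PSL(2, ℤ)) (k : ℤ) : parSubgroup Γ :=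
  ⟨⟨h * pslT ^ (Γ.index * k) * h⁻¹, conj_pslT_zpow_index_mul_mem h k⟩,
    mem_parSubgroup_of_eq_conj_pslT_zpow rfl⟩

theorem cuspTranslation_smul_smul (h : PSL(2, ℤ)) (k : ℤ) (z : ℍ) :
    cuspTranslation Γ h k • h • z = h • pslT ^ (Γ.index * k) • z := by
  change (h * pslT ^ (Γ.index * k) * h⁻¹) • h • z = _
  rw [smul_smul, smul_smul, inv_mul_cancel_right]

theorem cuspTranslation_smul_smul_horoball (h : PSL(2, ℤ)) (k : ℤ) :
    cuspTranslation Γ h k • h • horoball = h • horoball := by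
  change (fun z => cuspTranslation Γ h k • z) '' ((fun z => h • z) '' horoball) = _
  simp only [Set.image_image, cuspTranslation_smul_smul]
  conv_rhs => rw [← pslT_zpow_smul_horoball (Γ.index * k)]
  exact (Set.image_image _ _ _).symm

variable [Γ.FiniteIndex]

theorem cuspTranslation_injective (h : PSL(2, ℤ)) :
    Function.Injective (cuspTranslation Γ h) := by
  intro k l hkl
  have hval := congrArg (fun p : parSubgroup Γ => ((p : Γ) : PSL(2, ℤ))) hkl
  have hpow := pslT_zpow_injective (mul_left_cancel (mul_right_cancel hval))
  exact mul_left_cancel₀ (by exact_mod_cast Subgroup.FiniteIndex.index_ne_zero) hpow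

theorem exists_mem_smul_smul_cuspStrip {g : PSL(2, ℤ)} {z : ℍ} (hz : z ∈ g • horoball) :
    ∃ p : parSubgroup Γ, z ∈ p • g • cuspStrip (Set.Icc 0 Γ.index) 1 := by
  obtain ⟨w, hw, rfl⟩ := hz
  have hN : (0 : ℝ) < Γ.index := by
    exact_mod_cast Nat.pos_of_ne_zero Subgroup.FiniteIndex.index_ne_zero
  obtain ⟨k, hk, -⟩ := existsUnique_sub_zsmul_mem_Ico hN w.re 0
  refine ⟨cuspTranslation Γ g k, g • pslT ^ (Γ.index * -k) • w, ⟨_, ⟨?_, ?_⟩, rfl⟩, ?_⟩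
  · rw [re_pslT_zpow_smul]
    rw [zero_add, zsmul_eq_mul] at hk
    convert Set.Ico_subset_Icc_self hk using 1
    push_cast
    ring
  · rwa [im_pslT_zpow_smul]
  · change cuspTranslation Γ g k • g • pslT ^ (Γ.index * -k) • w = g • w
    rw [cuspTranslation_smul_smul, smul_smul (pslT ^ _) (pslT ^ _) w, ← zpow_add, mul_neg,
      add_neg_cancel, zpow_zero, one_smul]

end Parabolic

/-! ### Fundamental domains -/

section TameDomain

variable {H X : Type*} [Group H] [TopologicalSpace X] [MulAction H X]

theorem frontier_smul [ContinuousConstSMul H X] (h : H) (s : Set X) :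
    frontier (h • s) = h • frontier s :=
  ((Homeomorph.smul h).image_frontier s).symm

variable [MeasurableSpace X]

/-- A closed fundamental domain of `Γ` with finitely many connected sides of measure zero. This
weakening of `IsClosedFundamentalDomain` does not mention geodesics, and is therefore evidently
preserved by all homeomorphisms in the normalizer of `Γ`. -/
structure IsTameDomain (Γ : Subgroup H) (μ : Measure X) (D : Set X) : Prop where
  isClosed : IsClosed D
  covers : ⋃ γ : Γ, γ • D = Set.univ
  disjoint : ∀ γ : Γ, γ ≠ 1 → Disjoint (interior D) (interior (γ • D))
  locallyFinite : LocallyFinite fun γ : Γ => γ • D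
  frontier_null : μ (frontier D) = 0
  sides : ∃ A : Set (Set X), A.Finite ∧ frontier D = ⋃₀ A ∧ ∀ s ∈ A, IsPreconnected s

namespace IsTameDomain

variable {Γ : Subgroup H} {μ : Measure X} {D K : Set X}

theorem exists_mem_smul (hD : IsTameDomain Γ μ D) (x : X) : ∃ γ : Γ, x ∈ γ • D :=
  Set.mem_iUnion.mp (hD.covers ▸ Set.mem_univ x)

theorem exists_finite_subset_biUnion (hD : IsTameDomain Γ μ D) (hK : IsCompact K) :
    ∃ F : Set Γ, F.Finite ∧ K ⊆ ⋃ γ ∈ F, γ • D := by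
  refine ⟨_, hD.locallyFinite.finite_nonempty_inter_compact hK, fun x hx => ?_⟩
  obtain ⟨γ, hγ⟩ := hD.exists_mem_smul x
  exact Set.mem_biUnion (show _ from ⟨x, hγ, hx⟩) hγ

variable [ContinuousConstSMul H X]

theorem finite_smul_inter_nonempty [Γ.FiniteIndex] (hD : IsTameDomain Γ μ D) (hK : IsCompact K) :
    {h : H | (h • K ∩ D).Nonempty}.Finite := by
  obtain ⟨T, hT, -⟩ := Γ.exists_isComplement_right 1
  have hfin : (⋃ t ∈ T, (fun γ : Γ => (γ : H)⁻¹ * t) '' {γ | (γ • D ∩ t • K).Nonempty}).Finite :=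
    hT.finite_right.biUnion fun t _ =>
      (hD.locallyFinite.finite_nonempty_inter_compact (hK.smul t)).image _
  refine hfin.subset ?_
  rintro h ⟨x, hxK, hxD⟩
  obtain ⟨⟨⟨γ, hγ⟩, ⟨t, ht⟩⟩, rfl⟩ := hT.2 h
  refine Set.mem_biUnion ht ⟨⟨γ, hγ⟩⁻¹, ⟨γ⁻¹ • x, Set.smul_mem_smul_set (a := γ⁻¹) hxD, ?_⟩,
    by simp⟩
  rwa [← Set.mem_smul_set_iff_inv_smul_mem, smul_smul]

theorem smul [SMulInvariantMeasure H X μ] [Γ.Normal]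
    (hD : IsTameDomain Γ μ D) (h : H) : IsTameDomain Γ μ (h • D) := by
  have hconj (γ : Γ) : γ • h • D = h • (MulAut.conjNormal h⁻¹ γ : Γ) • D := by
    change (γ : H) • h • D = h • ((MulAut.conjNormal h⁻¹ γ : Γ) : H) • D
    rw [MulAut.conjNormal_apply, smul_smul, smul_smul]
    group
  refine ⟨hD.isClosed.smul h, ?_, fun γ hγ => ?_, ?_, ?_, ?_⟩
  · simp_rw [hconj]
    rw [(MulAut.conjNormal h⁻¹ : Γ ≃* Γ).surjective.iUnion_comp (fun γ : Γ => h • γ • D),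
      ← Set.smul_set_iUnion, hD.covers, Set.smul_set_univ]
  · rw [hconj, interior_smul, interior_smul, Set.disjoint_smul_set]
    exact hD.disjoint _ (by simpa using hγ)
  · simp_rw [hconj]
    have := hD.locallyFinite.preimage_continuous (continuous_const_smul h⁻¹)
    simp only [Set.preimage_smul_inv] at this
    exact this.comp_injective (MulAut.conjNormal h⁻¹ : Γ ≃* Γ).injective
  · rw [frontier_smul, measure_smul, hD.frontier_null]
  · obtain ⟨A, hA, hDA, hpre⟩ := hD.sides
    refine ⟨(h • ·) '' A, hA.image _, ?_, ?_⟩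
    · rw [frontier_smul, hDA, Set.sUnion_image, Set.sUnion_eq_biUnion]
      simp only [Set.smul_set_iUnion]
    · rintro _ ⟨s, hs, rfl⟩
      exact (hpre s hs).image _ (continuous_const_smul h).continuousOn

theorem pairwise_disjoint_interior_smul (hD : IsTameDomain Γ μ D) :
    Pairwise fun γ γ' : Γ => Disjoint (interior (γ • D)) (interior (γ' • D)) := by
  intro γ γ' hne
  have := hD.disjoint (γ⁻¹ * γ') (by rwa [Ne, inv_mul_eq_one])
  rw [← Set.disjoint_smul_set (a := (γ : H)), ← interior_smul, ← interior_smul] at this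
  change Disjoint (interior (γ • D)) (interior (γ • (γ⁻¹ * γ') • D)) at this
  rwa [smul_smul, mul_inv_cancel_left] at this

theorem measurableSet_biUnion_smul [OpensMeasurableSpace X] (hD : IsTameDomain Γ μ D)
    {F : Set Γ} (hF : F.Finite) :
    MeasurableSet (⋃ γ ∈ F, γ • D) :=
  (hF.isClosed_biUnion fun γ _ => hD.isClosed.smul (γ : H)).measurableSet

section Measure

variable [SMulInvariantMeasure H X μ]

theorem interior_smul_ae_eq (hD : IsTameDomain Γ μ D) (γ : Γ) :
    (interior (γ • D) : Set X) =ᵐ[μ] (γ • D : Set X) := by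
  refine interior_ae_eq_of_null_frontier ?_
  change μ (frontier ((γ : H) • D)) = 0
  rw [frontier_smul, measure_smul, hD.frontier_null]

theorem pairwise_aedisjoint_smul (hD : IsTameDomain Γ μ D) :
    Pairwise fun γ γ' : Γ => AEDisjoint μ (γ • D) (γ' • D) := fun γ γ' hne =>
  (hD.pairwise_disjoint_interior_smul hne).aedisjoint.congr (hD.interior_smul_ae_eq γ).symm
    (hD.interior_smul_ae_eq γ').symm

theorem aedisjoint (hD : IsTameDomain Γ μ D) {γ : Γ} (hγ : γ ≠ 1) : AEDisjoint μ D (γ • D) := by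
  simpa only [one_smul] using hD.pairwise_aedisjoint_smul hγ.symm

theorem exists_measurable_ae_forall_eq_of_mem_smul [OpensMeasurableSpace X] [Countable Γ]
    {β : Type*} [MeasurableSpace β] (hD : IsTameDomain Γ μ D) (b : Γ → β) :
    ∃ f : X → β, Measurable f ∧ ∀ᵐ x ∂μ, ∀ γ : Γ, x ∈ γ • D → f x = b γ := by
  obtain ⟨f, hf, hfb⟩ := exists_measurable_piecewise (fun γ : Γ => interior (γ • D))
    (fun γ => isOpen_interior.measurableSet) (fun γ _ => b γ) (fun γ => measurable_const)
    (fun γ γ' hne x hx => ((hD.pairwise_disjoint_interior_smul hne).le_bot hx).elim)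
  refine ⟨f, hf, ae_all_iff.mpr fun γ => ?_⟩
  filter_upwards [(hD.interior_smul_ae_eq γ).mem_iff] with x hx hxD
  exact hfb γ (hx.mpr hxD)

end Measure

end IsTameDomain

theorem IsGeodesicLine.volume_eq_zero {L : Set ℍ} (hL : IsGeodesicLine L) : volume L = 0 := by
  suffices volume (UpperHalfPlane.coe '' L : Set ℂ) = 0 by
    rw [UpperHalfPlane.volume_eq_lintegral]
    exact setLIntegral_measure_zero _ _ this
  rcases hL with ⟨a, rfl⟩ | ⟨a, r, hr, rfl⟩
  · have hline : volume ({a} ×ˢ Set.univ : Set (ℝ × ℝ)) = 0 := by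
      rw [Measure.volume_eq_prod, Measure.prod_prod, Real.volume_singleton, zero_mul]
    rw [← Complex.volume_preserving_equiv_real_prod.measure_preimage
      ((measurableSet_singleton a).prod MeasurableSet.univ).nullMeasurableSet] at hline
    refine measure_mono_null ?_ hline
    rintro _ ⟨z, hz, rfl⟩
    exact ⟨hz, trivial⟩
  · refine measure_mono_null ?_ (Measure.addHaar_sphere (volume : Measure ℂ) (a : ℂ) r)
    rintro _ ⟨z, hz, rfl⟩
    have hz : (z.re - a) ^ 2 + z.im ^ 2 = r ^ 2 := hz
    rw [mem_sphere_iff_norm, ← sq_eq_sq₀ (norm_nonneg _) hr.le, ← Complex.normSq_eq_norm_sq,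
      Complex.normSq_apply]
    simpa [sq] using hz

theorem IsClosedFundamentalDomain.isTameDomain {Γ : Subgroup PSL(2, ℤ)} {D : Set ℍ}
    (hD : IsClosedFundamentalDomain Γ D) : IsTameDomain Γ volume D where
  isClosed := hD.isClosed
  covers := hD.covers
  disjoint := hD.disjoint
  locallyFinite := hD.locallyFinite
  frontier_null := by
    obtain ⟨A, hA, hDA, hs⟩ := hD.sides
    rw [hDA, measure_sUnion_null_iff hA.countable]
    intro s hsA
    obtain ⟨-, L, hL, hsL⟩ := hs s hsA
    exact measure_mono_null hsL hL.volume_eq_zero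
  sides := by
    obtain ⟨A, hA, hDA, hs⟩ := hD.sides
    exact ⟨A, hA, hDA, fun s hsA => (hs s hsA).1⟩

end TameDomain

/-! ### Fundamental domains and cusps -/

section ModularDomain

theorem inter_frontier_nonempty_of_isPreconnected {X : Type*} [TopologicalSpace X] {s t : Set X}
    (hs : IsPreconnected s) (hst : (s ∩ t).Nonempty) (hsub : ¬ s ⊆ t) :
    (s ∩ frontier t).Nonempty := by
  by_contra hempty
  obtain ⟨x, hxs, hxt⟩ := hst
  obtain ⟨y, hys, hyt⟩ := Set.not_subset.mp hsub
  have hcover : s ⊆ interior t ∪ (closure t)ᶜ := fun z hz => by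
    by_contra hzn
    rw [Set.mem_union, Set.mem_compl_iff, not_or, not_not] at hzn
    exact hempty ⟨z, hz, hzn.2, hzn.1⟩
  obtain ⟨z, -, hzi, hzc⟩ := hs _ _ isOpen_interior isClosed_closure.isOpen_compl hcover
    ⟨x, hxs, (hcover hxs).resolve_right fun hn => hn (subset_closure hxt)⟩
    ⟨y, hys, (hcover hys).resolve_left fun hn => hyt (interior_subset hn)⟩
  exact hzc (subset_closure (interior_subset hzi))

theorem subset_smul_horoball_of_isPreconnected {s : Set ℍ} {g : PSL(2, ℤ)}
    (hs : IsPreconnected s) (hne : (s ∩ g • horoball).Nonempty) (hg : ∀ z ∈ s, (g⁻¹ • z).im ≠ 1) :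
    s ⊆ g • horoball := by
  obtain ⟨z, hz, hzg⟩ := hne
  by_contra hsub
  obtain ⟨w, hw, hwg⟩ := Set.not_subset.mp hsub
  rw [Set.mem_smul_set_iff_inv_smul_mem] at hzg hwg
  have hcont : ContinuousOn (fun z : ℍ => (g⁻¹ • z).im) s :=
    (continuous_im.comp (continuous_const_smul g⁻¹)).continuousOn
  obtain ⟨v, hv, hv1⟩ := hs.intermediate_value hw hz hcont
    (show (1 : ℝ) ∈ Set.Icc _ _ from ⟨not_lt.mp hwg, le_of_lt hzg⟩)
  exact hg v hv hv1

theorem exists_mem_smul_truncatedFundamentalDomain_of_im_eq_one {g : PSL(2, ℤ)} {z : ℍ}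
    (hz : (g⁻¹ • z).im = 1) : ∃ h : PSL(2, ℤ),
      z ∈ h • ModularGroup.truncatedFundamentalDomain 1 ∧ h • horoball = g • horoball := by
  obtain ⟨k, hk⟩ := exists_pslT_zpow_smul_mem_truncatedFundamentalDomain hz
  refine ⟨g * pslT ^ (-k), ?_, by rw [mul_smul, pslT_zpow_smul_horoball]⟩
  rwa [Set.mem_smul_set_iff_inv_smul_mem, mul_inv_rev, mul_smul, zpow_neg, inv_inv]

namespace IsTameDomain

variable {Γ : Subgroup PSL(2, ℤ)} [Γ.Normal] [Γ.FiniteIndex] {μ : Measure ℍ} {D D' : Set ℍ}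

theorem not_smul_horoball_subset (hD : IsTameDomain Γ μ D) (g : PSL(2, ℤ)) :
    ¬ g • horoball ⊆ D := by
  intro hsub
  let γ : Γ := cuspTranslation Γ g 1
  have hγ : γ ≠ 1 := by
    have h10 : cuspTranslation Γ g 1 ≠ cuspTranslation Γ g 0 :=
      (cuspTranslation_injective g).ne one_ne_zero
    intro h
    refine h10 (Subtype.ext (h.trans (Subtype.ext ?_)))
    simp [cuspTranslation]
  have hopen : IsOpen (g • horoball) := isOpen_horoball.smul g
  have hsubγ : g • horoball ⊆ γ • D :=
    (cuspTranslation_smul_smul_horoball (Γ := Γ) g 1).symm.subset.trans (Set.smul_set_mono hsub)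
  obtain ⟨z, hz⟩ : (g • horoball).Nonempty := horoball_nonempty.smul_set
  exact Set.disjoint_left.mp (hD.disjoint γ hγ) (interior_maximal hsub hopen hz)
    (interior_maximal hsubγ hopen hz)

/-- A horoball that meets `D` is not contained in `D`, hence it meets a side. Either the side is
contained in it, or `D` has a point on the horocycle; up to finitely many exceptions neither can
happen, since horoballs are disjoint and horocycles are covered by translates of one compact set. -/
theorem finite_orbit_horoball_inter_nonempty (hD : IsTameDomain Γ μ D) :
    {B ∈ MulAction.orbit PSL(2, ℤ) horoball | (B ∩ D).Nonempty}.Finite := by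
  obtain ⟨A, hA, hDA, hs⟩ := hD.sides
  have hcompact : ((fun g : PSL(2, ℤ) => g • horoball) ''
      {g | (g • ModularGroup.truncatedFundamentalDomain 1 ∩ D).Nonempty}).Finite :=
    (hD.finite_smul_inter_nonempty (ModularGroup.isCompact_truncatedFundamentalDomain 1)).image _
  have hsides :
      (⋃ s ∈ A, {B ∈ MulAction.orbit PSL(2, ℤ) horoball | s ⊆ B ∧ s.Nonempty}).Finite := by
    refine hA.biUnion fun s _ => Set.Subsingleton.finite ?_
    rintro _ ⟨⟨g, rfl⟩, hg, z, hz⟩ _ ⟨⟨g', rfl⟩, hg', -⟩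
    exact smul_horoball_eq_of_inter_nonempty ⟨z, hg hz, hg' hz⟩
  refine (hcompact.union hsides).subset ?_
  rintro _ ⟨⟨g, rfl⟩, hne⟩
  by_cases hlevel : ∃ z ∈ D, (g⁻¹ • z).im = 1
  · left
    obtain ⟨z, hz, hz1⟩ := hlevel
    obtain ⟨h, hzh, hhg⟩ := exists_mem_smul_truncatedFundamentalDomain_of_im_eq_one hz1
    exact ⟨h, ⟨z, hzh, hz⟩, hhg⟩
  · right
    push Not at hlevel
    have hpre : IsPreconnected (g • horoball) :=
      isPreconnected_horoball.image _ (continuous_const_smul g).continuousOn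
    obtain ⟨z, hzg, hzD⟩ := inter_frontier_nonempty_of_isPreconnected hpre hne
      (hD.not_smul_horoball_subset g)
    obtain ⟨s, hsA, hzs⟩ := hDA ▸ hzD
    have hsD : s ⊆ D := (Set.subset_sUnion_of_mem hsA).trans
      (hDA ▸ hD.isClosed.frontier_subset)
    exact Set.mem_biUnion hsA ⟨⟨g, rfl⟩, subset_smul_horoball_of_isPreconnected (hs s hsA)
      ⟨z, hzs, hzg⟩ fun w hw => hlevel w (hsD hw), z, hzs⟩

theorem exists_subset_iUnion_smul_cuspStrip (hD : IsTameDomain Γ μ D) :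
    ∃ (K : Set ℍ) (F : Set PSL(2, ℤ)), IsCompact K ∧ F.Finite ∧
      D ⊆ ⋃ p : parSubgroup Γ, p • (K ∪ ⋃ g ∈ F, g • cuspStrip (Set.Icc 0 Γ.index) 1) := by
  have hFD := ModularGroup.isCompact_truncatedFundamentalDomain 1
  obtain ⟨F, -, hF⟩ := Set.exists_subset_bijOn {g : PSL(2, ℤ) | (g • horoball ∩ D).Nonempty}
    (fun g => g • horoball)
  have hFfin : F.Finite := hF.finite_iff_finite.mpr
    (hD.finite_orbit_horoball_inter_nonempty.subset <| by
      rintro _ ⟨g, hg, rfl⟩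
      exact ⟨⟨g, rfl⟩, hg⟩)
  refine ⟨_, F, (hD.finite_smul_inter_nonempty hFD).isCompact_biUnion fun g _ => hFD.smul g, hFfin,
    fun z hz => ?_⟩
  obtain ⟨g, hg | hg⟩ := exists_mem_smul_truncatedFundamentalDomain_or_horoball z
  · refine Set.mem_iUnion.mpr ⟨1, ?_⟩
    rw [one_smul]
    exact Or.inl (Set.mem_biUnion (show _ from ⟨z, hg, hz⟩) hg)
  · obtain ⟨g', hg', hgg'⟩ := hF.surjOn ⟨g, ⟨z, hg, hz⟩, rfl⟩
    have hzg' : z ∈ g' • horoball := hgg'.symm.subset hg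
    obtain ⟨p, hp⟩ := exists_mem_smul_smul_cuspStrip (Γ := Γ) hzg'
    exact Set.mem_iUnion.mpr ⟨p, Set.smul_set_mono
      ((Set.subset_biUnion_of_mem hg').trans Set.subset_union_right) hp⟩

theorem exists_smul_horoball_subset_iUnion (hD : IsTameDomain Γ μ D) (g : PSL(2, ℤ)) :
    ∃ F : Set Γ, F.Finite ∧ g • horoball ⊆ ⋃ p : parSubgroup Γ, p • ⋃ γ ∈ F, γ • D := by
  obtain ⟨F, -, hF⟩ := Set.exists_subset_bijOn {γ : Γ | (γ⁻¹ • g • horoball ∩ D).Nonempty}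
    (fun γ => γ⁻¹ • g • horoball)
  have hFfin : F.Finite := hF.finite_iff_finite.mpr
    (hD.finite_orbit_horoball_inter_nonempty.subset <| by
      rintro _ ⟨γ, hγ, rfl⟩
      exact ⟨⟨(γ : PSL(2, ℤ))⁻¹ * g, mul_smul _ _ _⟩, hγ⟩)
  refine ⟨F, hFfin, fun z hz => ?_⟩
  obtain ⟨γ, hγ⟩ := hD.exists_mem_smul z
  have hzD : γ⁻¹ • z ∈ D := Set.mem_smul_set_iff_inv_smul_mem.mp hγ
  have hzg : γ⁻¹ • z ∈ γ⁻¹ • g • horoball := Set.smul_mem_smul_set (a := γ⁻¹) hz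
  obtain ⟨δ, hδ, hδγ⟩ := hF.surjOn ⟨γ, ⟨_, hzg, hzD⟩, rfl⟩
  have hpz : (δ * γ⁻¹) • z ∈ g • horoball := by
    rw [mul_smul, ← inv_inv δ, ← Set.mem_smul_set_iff_inv_smul_mem]
    exact hδγ.symm.subset hzg
  have hp := inv_mem (mem_parSubgroup_of_smul_mem_horoball hz hpz)
  refine Set.mem_iUnion.mpr ⟨⟨_, hp⟩, Set.mem_smul_set_iff_inv_smul_mem.mpr
    (Set.mem_biUnion hδ (Set.mem_smul_set_iff_inv_smul_mem.mpr ?_))⟩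
  change δ⁻¹ • (δ * γ⁻¹)⁻¹⁻¹ • z ∈ D
  rwa [inv_inv, mul_smul, inv_smul_smul]

theorem exists_subset_iUnion_smul (hD : IsTameDomain Γ μ D) (hD' : IsTameDomain Γ μ D') :
    ∃ F : Set Γ, F.Finite ∧ D' ⊆ ⋃ p : parSubgroup Γ, p • ⋃ γ ∈ F, γ • D := by
  obtain ⟨K, T, hK, hT, hsub⟩ := hD'.exists_subset_iUnion_smul_cuspStrip
  obtain ⟨C, hC, hKC⟩ := hD.exists_finite_subset_biUnion hK
  choose E hE hgE using hD.exists_smul_horoball_subset_iUnion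
  refine ⟨C ∪ ⋃ g ∈ T, E g, hC.union (hT.biUnion fun g _ => hE g), fun z hz => ?_⟩
  obtain ⟨p, w, hw | hw, rfl⟩ := Set.mem_iUnion.mp (hsub hz)
  · exact Set.mem_iUnion.mpr ⟨p, Set.smul_mem_smul_set
      (Set.biUnion_subset_biUnion_left Set.subset_union_left (hKC hw))⟩
  · obtain ⟨g, hg, hw⟩ := Set.mem_iUnion₂.mp hw
    have hwg : w ∈ g • horoball := Set.smul_set_mono (cuspStrip_subset_horoball _) hw
    obtain ⟨p', v, hv, rfl⟩ := Set.mem_iUnion.mp (hgE g hwg)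
    refine Set.mem_iUnion.mpr ⟨p * p', v, Set.biUnion_subset_biUnion_left ?_ hv, mul_smul _ _ _⟩
    exact (Set.subset_biUnion_of_mem (u := E) hg).trans Set.subset_union_right

end IsTameDomain

end ModularDomain

/-! ### Higher order invariant functions on the upper half plane -/

section Forms

variable {Γ : Subgroup PSL(2, ℤ)} {q : ℕ}

theorem mem_formsF_zero_iff {f : ℍ →ₘ[volume] ℂ} :
    f ∈ formsF Γ 0 ↔ ∀ γ : Γ, translation (γ : PSL(2, ℤ)) f = f :=
  mem_higherInvariants_zero_iff _ _

theorem domMulAct_mk_smul (γ : PSL(2, ℤ)) (f : ℍ →ₘ[volume] ℂ) :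
    DomMulAct.mk γ • f = translation γ⁻¹ f := by
  simp [translation]

theorem exists_energy_asAlgebraHom_le (D : Set ℍ) {T : Set Γ} {a : MonoidAlgebra ℂ Γ}
    (ha : a ∈ Submodule.span ℂ (MonoidAlgebra.of ℂ Γ '' T)) :
    ∃ C : ℝ≥0, ∀ f : ℍ →ₘ[volume] ℂ,
      energy D (Representation.asAlgebraHom (translation.comp Γ.subtype) a f) ≤
        C * energy (T⁻¹ • D) f := by
  induction ha using Submodule.span_induction with
  | mem _ hγ =>
    obtain ⟨γ, hγ, rfl⟩ := hγ
    refine ⟨1, fun f => ?_⟩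
    rw [Representation.asAlgebraHom_of, ENNReal.coe_one, one_mul]
    refine (energy_translation (γ : PSL(2, ℤ)) D f).trans_le (energy_mono ?_ f)
    exact Set.smul_set_subset_smul (a := γ⁻¹) (Set.inv_mem_inv.mpr hγ)
  | zero => exact ⟨0, fun f => by simp [energy_eq_zero_iff.mpr, AEEqFun.coeFn_zero.restrict]⟩
  | add a b _ _ ha hb =>
    obtain ⟨A, hA⟩ := ha
    obtain ⟨B, hB⟩ := hb
    refine ⟨2 * (A + B), fun f => ?_⟩
    rw [map_add, LinearMap.add_apply]
    refine (energy_add_le _ _ _).trans ?_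
    push_cast
    rw [mul_assoc, add_mul]
    gcongr
    exacts [hA f, hB f]
  | smul c a _ ha =>
    obtain ⟨A, hA⟩ := ha
    refine ⟨‖c‖₊ ^ 2 * A, fun f => ?_⟩
    rw [map_smul, LinearMap.smul_apply, energy_const_smul, ENNReal.rpow_two]
    push_cast
    rw [mul_assoc, ← enorm_eq_nnnorm]
    gcongr
    exact hA f

theorem IsTameDomain.energy_le {D D' : Set ℍ} (hD : IsTameDomain Γ volume D)
    (hD' : IsTameDomain Γ volume D') {f : ℍ →ₘ[volume] ℂ} (hf : f ∈ formsF Γ 0) :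
    energy D f ≤ energy D' f :=
  energy_le_of_subset_iUnion_smul (G := Γ)
    (fun γ => (domMulAct_mk_smul (γ : PSL(2, ℤ)) f).trans (mem_formsF_zero_iff.mp hf γ⁻¹))
    hD.isClosed.measurableSet (fun _ => hD.aedisjoint) hD'.isClosed.measurableSet
    (hD'.covers.symm ▸ Set.subset_univ _)

theorem IsTameDomain.energy_eq {D D' : Set ℍ} (hD : IsTameDomain Γ volume D)
    (hD' : IsTameDomain Γ volume D') {f : ℍ →ₘ[volume] ℂ} (hf : f ∈ formsF Γ 0) :
    energy D f = energy D' f :=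
  le_antisymm (hD.energy_le hD' hf) (hD'.energy_le hD hf)

theorem IsTameDomain.eq_zero_of_energy_smul_eq_zero {D : Set ℍ} (hD : IsTameDomain Γ volume D)
    {f : ℍ →ₘ[volume] ℂ} (hf : ∀ γ : Γ, energy (γ • D) f = 0) : f = 0 := by
  have huniv : energy Set.univ f = 0 := by
    rw [← hD.covers, ← nonpos_iff_eq_zero]
    exact (energy_iUnion_le _ f).trans (by simp [hf])
  rw [energy_eq_zero_iff, Measure.restrict_univ] at huniv
  exact AEEqFun.ext (huniv.trans AEEqFun.coeFn_zero.symm)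

namespace DomainChoice

theorem tile_eq_biUnion (c : DomainChoice Γ) (q : ℕ) : c.tile q = ⋃ γ ∈ c.S ^ q, γ • c.D :=
  (Set.iUnion_smul_set (c.S ^ q) c.D).symm

theorem finite_pow (c : DomainChoice Γ) (q : ℕ) : (c.S ^ q).Finite := by
  induction q with
  | zero => simp
  | succ q ih =>
    rw [pow_succ]
    exact ih.mul c.finite

theorem subset_tile (c : DomainChoice Γ) (q : ℕ) : c.D ⊆ c.tile q := by
  rw [tile]
  simpa only [one_smul] using Set.smul_set_subset_smul (t := c.D) (Set.one_mem_pow c.one_mem)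

theorem inv_eq (c : DomainChoice Γ) : c.S⁻¹ = c.S :=
  Set.Subset.antisymm (fun s hs => inv_inv s ▸ c.symm _ hs) c.symm

theorem closure_eq_top (c : DomainChoice Γ) : Submonoid.closure c.S = ⊤ := by
  have := Subgroup.closure_toSubmonoid c.S
  rwa [c.generates, c.inv_eq, Set.union_self, eq_comm] at this

theorem energyDominated_smul (c : DomainChoice Γ) (q : ℕ) (γ : Γ) :
    EnergyDominated (formsF Γ q : Set (ℍ →ₘ[volume] ℂ)) (γ • c.D) (c.tile q) := by
  obtain ⟨a, ha, heq⟩ := exists_mem_span_pow_apply_eq (translation.comp Γ.subtype) (parSubgroup Γ)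
    c.one_mem c.closure_eq_top q γ⁻¹
  obtain ⟨C, hC⟩ := exists_energy_asAlgebraHom_le c.D ha
  rw [← inv_pow, c.inv_eq] at hC
  refine ⟨C, fun f hf => ?_⟩
  have htrans : energy (γ • c.D) f = energy c.D (translation ((γ⁻¹ : Γ) : PSL(2, ℤ)) f) := by
    rw [energy_translation, Subgroup.coe_inv, inv_inv]
    rfl
  rw [htrans]
  exact (congrArg (energy c.D) (heq f hf)).trans_le (hC f)

theorem eq_of_ae_eq_tile (c : DomainChoice Γ) {f g : ℍ →ₘ[volume] ℂ}
    (hf : f ∈ formsF Γ q) (hg : g ∈ formsF Γ q) (hfg : f =ᵐ[volume.restrict (c.tile q)] g) :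
    f = g := by
  rw [← sub_eq_zero]
  refine c.isDomain.isTameDomain.eq_zero_of_energy_smul_eq_zero fun γ => ?_
  have htile : energy (c.tile q) (f - g) = 0 := by
    rw [energy_eq_zero_iff]
    filter_upwards [hfg, ae_restrict_of_ae (AEEqFun.coeFn_sub f g)] with z hz hsub
    rw [hsub, Pi.sub_apply, hz, sub_self, Pi.zero_apply]
  obtain ⟨C, hC⟩ := c.energyDominated_smul q γ
  simpa [htile] using hC _ (sub_mem hf hg)

end DomainChoice

theorem translation_eq_of_mem_parSubgroup {f : ℍ →ₘ[volume] ℂ} (hf : f ∈ formsF Γ q) {p : Γ}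
    (hp : p ∈ parSubgroup Γ) : translation (p : PSL(2, ℤ)) f = f :=
  apply_eq_of_mem_higherInvariants _ hf hp

theorem energy_le_of_subset_iUnion_parSubgroup_smul {A B : Set ℍ} {f : ℍ →ₘ[volume] ℂ}
    (hf : f ∈ formsF Γ q) (hA : MeasurableSet A)
    (hdisj : ∀ p ∈ parSubgroup Γ, p ≠ 1 → AEDisjoint volume A (p • A)) (hB : MeasurableSet B)
    (hsub : A ⊆ ⋃ p : parSubgroup Γ, p • B) : energy A f ≤ energy B f := by
  have hinv (p : parSubgroup Γ) : DomMulAct.mk p • f = f := by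
    change DomMulAct.mk ((p : Γ) : PSL(2, ℤ)) • f = f
    rw [domMulAct_mk_smul, ← Subgroup.coe_inv]
    exact translation_eq_of_mem_parSubgroup hf (inv_mem p.2)
  exact energy_le_of_subset_iUnion_smul hinv hA
    (fun p hp => hdisj p p.2 (by simpa using hp)) hB hsub

variable [Γ.Normal]

theorem formsF_mono : Monotone (formsF Γ) :=
  higherInvariants_mono _ _

theorem mem_formsF_succ_iff {f : ℍ →ₘ[volume] ℂ} :
    f ∈ formsF Γ (q + 1) ↔ (∀ γ : Γ, translation (γ : PSL(2, ℤ)) f - f ∈ formsF Γ q) ∧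
      ∀ p ∈ parSubgroup Γ, translation (p : PSL(2, ℤ)) f = f :=
  mem_higherInvariants_succ_iff _ _

theorem translation_mem_formsF (g : PSL(2, ℤ)) {f : ℍ →ₘ[volume] ℂ} (hf : f ∈ formsF Γ q) :
    translation g f ∈ formsF Γ q :=
  apply_mem_higherInvariants_of_normal translation (fun h _ => conjNormal_mem_parSubgroup h) g hf

variable [Γ.FiniteIndex]

namespace DomainChoice

theorem energyDominated_tile (c : DomainChoice Γ) (q : ℕ) {D : Set ℍ}
    (hD : IsTameDomain Γ volume D) :
    EnergyDominated (formsF Γ q : Set (ℍ →ₘ[volume] ℂ)) D (c.tile q) := by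
  obtain ⟨F, hF, hsub⟩ := c.isDomain.isTameDomain.exists_subset_iUnion_smul hD
  refine EnergyDominated.trans (B := ⋃ γ ∈ F, γ • c.D) (.of_forall_le fun f hf => ?_)
    (.biUnion hF fun γ _ => c.energyDominated_smul q γ)
  exact energy_le_of_subset_iUnion_parSubgroup_smul hf hD.isClosed.measurableSet
    (fun _ _ => hD.aedisjoint) (c.isDomain.isTameDomain.measurableSet_biUnion_smul hF) hsub

theorem energyDominated_smul_tile (c c' : DomainChoice Γ) (q : ℕ) (g : PSL(2, ℤ)) :
    EnergyDominated (formsF Γ q : Set (ℍ →ₘ[volume] ℂ)) (g • c'.tile q) (c.tile q) := by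
  rw [c'.tile_eq_biUnion]
  simp only [Set.smul_set_iUnion]
  exact .biUnion (c'.finite_pow q) fun γ _ =>
    c.energyDominated_tile q ((c'.isDomain.isTameDomain.smul (γ : PSL(2, ℤ))).smul g)

end DomainChoice

end Forms

/-! ### Local square integrability on the Borel-Serre space -/

section BorelSerre

theorem isCompact_setOf_re_mem_im_mem {I J : Set ℝ} (hI : IsCompact I) (hJ : IsCompact J)
    (hJpos : J ⊆ Set.Ioi 0) : IsCompact {z : ℍ | z.re ∈ I ∧ z.im ∈ J} := by
  rw [isEmbedding_coe.isCompact_iff]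
  convert hI.reProdIm hJ using 1
  ext w
  constructor
  · rintro ⟨z, hz, rfl⟩
    exact hz
  · rintro hw
    exact ⟨⟨w, hJpos hw.2⟩, hw, rfl⟩

section UpperTriangular

theorem sl2_ne_zero_and_eq_inv_of_lowerLeft_eq_zero {K : Type*} [Field K] {b : SL(2, K)}
    (hb : b 1 0 = 0) : b 0 0 ≠ 0 ∧ b 1 1 = (b 0 0)⁻¹ := by
  have hdet := Matrix.det_fin_two (b : Matrix (Fin 2) (Fin 2) K)
  rw [b.det_coe, hb, mul_zero, sub_zero] at hdet
  exact ⟨left_ne_zero_of_mul_eq_one hdet.symm, eq_inv_of_mul_eq_one_right hdet.symm⟩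

variable {b : SL(2, ℝ)}

theorem coe_smul_of_lowerLeft_eq_zero (hb : b 1 0 = 0) (z : ℍ) :
    ((b • z : ℍ) : ℂ) = ((b 0 0 ^ 2 : ℝ) : ℂ) * z + ((b 0 0 * b 0 1 : ℝ) : ℂ) := by
  have hd := (sl2_ne_zero_and_eq_inv_of_lowerLeft_eq_zero hb).2
  rw [coe_specialLinearGroup_apply, hb, hd]
  simp only [Algebra.algebraMap_self, RingHom.id_apply, Complex.ofReal_inv, Complex.ofReal_zero,
    zero_mul, zero_add, div_inv_eq_mul, Complex.ofReal_pow, Complex.ofReal_mul]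
  ring

theorem re_smul_of_lowerLeft_eq_zero (hb : b 1 0 = 0) (z : ℍ) :
    (b • z).re = b 0 0 ^ 2 * z.re + b 0 0 * b 0 1 := by
  rw [← coe_re, coe_smul_of_lowerLeft_eq_zero hb, Complex.add_re, Complex.re_ofReal_mul,
    Complex.ofReal_re, coe_re]

theorem im_smul_of_lowerLeft_eq_zero (hb : b 1 0 = 0) (z : ℍ) :
    (b • z).im = b 0 0 ^ 2 * z.im := by
  rw [← coe_im, coe_smul_of_lowerLeft_eq_zero hb, Complex.add_im, Complex.im_ofReal_mul,
    Complex.ofReal_im, coe_im, add_zero]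

theorem smul_coe_of_lowerLeft_eq_zero (hb : b 1 0 = 0) (x : ℝ) :
    (b : GL (Fin 2) ℝ) • (x : OnePoint ℝ) =
      ((b 0 0 ^ 2 * x + b 0 0 * b 0 1 : ℝ) : OnePoint ℝ) := by
  obtain ⟨ha, hd⟩ := sl2_ne_zero_and_eq_inv_of_lowerLeft_eq_zero hb
  rw [OnePoint.smul_some_eq_ite]
  simp only [Matrix.SpecialLinearGroup.coe_GL_coe_matrix, hb, hd, zero_mul, zero_add,
    inv_eq_zero, ha, if_false]
  congr 1
  field_simp

theorem exists_forall_smul_mem_cuspStrip (hb : b 1 0 = 0) {I : Set ℝ} (hI : IsOpen I) {x : ℝ}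
    (hx : b 0 0 ^ 2 * x + b 0 0 * b 0 1 ∈ I) :
    ∃ ε > 0, (∀ y, |y - x| < ε → b 0 0 ^ 2 * y + b 0 0 * b 0 1 ∈ I) ∧
      ∀ z : ℍ, |z.re - x| < ε → 1 / ε < z.im → b • z ∈ cuspStrip I 1 := by
  have ha : 0 < b 0 0 ^ 2 := by
    have := (sl2_ne_zero_and_eq_inv_of_lowerLeft_eq_zero hb).1
    positivity
  have hcont : Continuous fun y : ℝ => b 0 0 ^ 2 * y + b 0 0 * b 0 1 := by fun_prop
  obtain ⟨δ, hδ, hδI⟩ := Metric.isOpen_iff.mp (hI.preimage hcont) x hx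
  have hre (y : ℝ) (hy : |y - x| < min δ (b 0 0 ^ 2)) : b 0 0 ^ 2 * y + b 0 0 * b 0 1 ∈ I :=
    hδI (hy.trans_le (min_le_left _ _))
  refine ⟨min δ (b 0 0 ^ 2), lt_min hδ ha, hre, fun z hzre hzim => ⟨?_, ?_⟩⟩
  · rw [re_smul_of_lowerLeft_eq_zero hb]
    exact hre z.re hzre
  · rw [im_smul_of_lowerLeft_eq_zero hb, mul_comm, ← div_lt_iff₀ ha]
    exact (one_div_le_one_div_of_le (lt_min hδ ha) (min_le_right _ _)).trans_lt hzim

end UpperTriangular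

theorem BorelSerre.isOpenEmbedding_inner (Γ : Subgroup PSL(2, ℤ)) :
    Topology.IsOpenEmbedding (BorelSerre.inner : ℍ → BorelSerre Γ) := by
  have hinj : Function.Injective (BorelSerre.inner : ℍ → BorelSerre Γ) :=
    fun _ _ => BorelSerre.inner.inj
  refine .of_continuous_injective_isOpenMap ⟨fun _ hU => hU.1⟩ hinj fun U hU => ⟨?_, ?_⟩
  · rwa [Set.preimage_image_eq U hinj]
  · rintro _ _ _ _ _ _ _ _ ⟨z, -, hz⟩
    cases hz

/-- The part of the horoball `g {Im z > 1}` over `I`, together with the points `g x` for `x ∈ I`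
of the boundary line at the cusp `g ∞`. -/
def cuspNhd (Γ : Subgroup PSL(2, ℤ)) (g : SL(2, ℝ)) (I : Set ℝ) : Set (BorelSerre Γ) :=
  {b | match b with
    | .inner z => g⁻¹ • z ∈ cuspStrip I 1
    | .bdry c p _ _ => c = (g : GL (Fin 2) ℝ) • OnePoint.infty ∧
        ∃ x ∈ I, p = (g : GL (Fin 2) ℝ) • ((x : ℝ) : OnePoint ℝ)}

variable {Γ : Subgroup PSL(2, ℤ)} {f : ℍ →ₘ[volume] ℂ}

theorem isOpen_cuspNhd (g : SL(2, ℝ)) {I : Set ℝ} (hI : IsOpen I) : IsOpen (cuspNhd Γ g I) := by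
  constructor
  · have hg : Continuous fun z : ℍ => g⁻¹ • z := continuous_const_smul g⁻¹
    exact (hI.preimage (continuous_re.comp hg)).inter
      (isOpen_lt continuous_const (continuous_im.comp hg))
  · rintro g' x c p hc - rfl rfl ⟨hcusp, x', hx', hfoot⟩
    obtain ⟨b, rfl⟩ : ∃ b, g' = g * b := ⟨g⁻¹ * g', (mul_inv_cancel_left g g').symm⟩
    rw [map_mul, mul_smul, smul_left_cancel_iff, OnePoint.smul_infty_eq_self_iff] at hcusp
    have hb : b 1 0 = 0 := hcusp
    rw [map_mul, mul_smul, smul_left_cancel_iff, smul_coe_of_lowerLeft_eq_zero hb,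
      OnePoint.coe_eq_coe] at hfoot
    obtain ⟨ε, hε, hbdry, hinner⟩ := exists_forall_smul_mem_cuspStrip hb hI (hfoot ▸ hx')
    refine ⟨ε, hε, fun z hzre hzim => ?_, fun y p' _ hy hpy => ⟨?_, _, hbdry y hy, ?_⟩⟩
    · change g⁻¹ • (g * b) • z ∈ cuspStrip I 1
      rw [mul_smul, inv_smul_smul]
      exact hinner z hzre hzim
    · rw [map_mul, mul_smul, OnePoint.smul_infty_eq_self_iff.mpr hcusp]
    · rw [hpy, map_mul, mul_smul, smul_coe_of_lowerLeft_eq_zero hb]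

theorem energy_lt_top_of_mem_L2loc (hf : f ∈ L2loc Γ) {K : Set ℍ} (hK : IsCompact K) :
    energy K f < ∞ := by
  refine hK.induction_on (p := fun s => energy s f < ∞) (by simp [energy])
    (fun s t hst ht => (energy_mono hst f).trans_lt ht) (fun s t => energy_union_lt_top)
    fun z _ => ?_
  obtain ⟨U, hU, hfU⟩ := hf (BorelSerre.inner z)
  exact ⟨_, mem_nhdsWithin_of_mem_nhds
    ((BorelSerre.isOpenEmbedding_inner Γ).continuous.continuousAt hU),
    memLp_two_restrict_iff.mp hfU⟩

variable [Γ.FiniteIndex]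

theorem isCusp_liftGL_iff {c : OnePoint ℝ} :
    IsCusp c (liftGL Γ) ↔
      ∃ h : SL(2, ℤ), c = Matrix.SpecialLinearGroup.mapGL ℝ h • OnePoint.infty := by
  have : (Γ.comap (QuotientGroup.mk' (Subgroup.center SL(2, ℤ)))).FiniteIndex := by
    refine ⟨?_⟩
    rw [Subgroup.index_comap_of_surjective _ (QuotientGroup.mk'_surjective _)]
    exact Subgroup.FiniteIndex.index_ne_zero
  rw [liftGL, Subgroup.IsArithmetic.isCusp_iff_isCusp_SL2Z, isCusp_SL2Z_iff']

theorem exists_energy_smul_cuspStrip_lt_top_of_mem_L2loc (hf : f ∈ L2loc Γ) (h : SL(2, ℤ))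
    {J : Set ℝ} (hJ : IsCompact J) :
    ∃ Y, energy ((h : PSL(2, ℤ)) • cuspStrip J Y) f < ∞ := by
  refine hJ.induction_on
    (p := fun s => ∃ Y, energy ((h : PSL(2, ℤ)) • cuspStrip s Y) f < ∞)
    ⟨0, by simp [energy, cuspStrip]⟩ ?_ ?_ fun x _ => ?_
  · rintro s t hst ⟨Y, hY⟩
    refine ⟨Y, (energy_mono (Set.smul_set_mono ?_) f).trans_lt hY⟩
    exact fun z hz => ⟨hst hz.1, hz.2⟩
  · rintro s t ⟨Y, hY⟩ ⟨Y', hY'⟩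
    refine ⟨max Y Y', (energy_mono ?_ f).trans_lt (energy_union_lt_top hY hY')⟩
    rw [← Set.smul_set_union]
    refine Set.smul_set_mono ?_
    rintro z ⟨hre | hre, him⟩
    · exact .inl ⟨hre, (le_max_left Y Y').trans_lt him⟩
    · exact .inr ⟨hre, (le_max_right Y Y').trans_lt him⟩
  · let g : SL(2, ℝ) := Matrix.SpecialLinearGroup.map (Int.castRingHom ℝ) h
    have hx : (g : GL (Fin 2) ℝ) • (x : OnePoint ℝ) ≠ (g : GL (Fin 2) ℝ) • OnePoint.infty :=
      (smul_left_cancel_iff _).not.mpr (OnePoint.coe_ne_infty x)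
    obtain ⟨U, hU, hfU⟩ := hf (.bdry _ _ (isCusp_liftGL_iff.mpr ⟨h, rfl⟩) hx)
    obtain ⟨V, hVU, hV, hxV⟩ := mem_nhds_iff.mp hU
    obtain ⟨ε, hε, hinner, -⟩ := hV.2 g x _ _ _ hx rfl rfl hxV
    refine ⟨_, mem_nhdsWithin_of_mem_nhds (Metric.ball_mem_nhds x hε), 1 / ε,
      (energy_mono ?_ f).trans_lt (memLp_two_restrict_iff.mp hfU)⟩
    rintro _ ⟨z, ⟨hzre, hzim⟩, rfl⟩
    exact hVU (hinner z hzre hzim)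

theorem energy_smul_cuspStrip_lt_top_of_mem_L2loc (hf : f ∈ L2loc Γ) (g : PSL(2, ℤ))
    {J : Set ℝ} (hJ : IsCompact J) : energy (g • cuspStrip J 1) f < ∞ := by
  induction g using QuotientGroup.induction_on with
  | H h =>
    obtain ⟨Y, hY⟩ := exists_energy_smul_cuspStrip_lt_top_of_mem_L2loc hf h hJ
    have hK : IsCompact ((h : PSL(2, ℤ)) • {z : ℍ | z.re ∈ J ∧ z.im ∈ Set.Icc 1 Y}) :=
      (isCompact_setOf_re_mem_im_mem hJ isCompact_Icc
        fun y hy => one_pos.trans_le hy.1).smul (h : PSL(2, ℤ))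
    refine (energy_mono ?_ f).trans_lt
      (energy_union_lt_top hY (energy_lt_top_of_mem_L2loc hf hK))
    rw [← Set.smul_set_union]
    exact Set.smul_set_mono fun z hz => (lt_or_ge Y z.im).imp (⟨hz.1, ·⟩) (⟨hz.1, hz.2.le, ·⟩)

theorem mem_L2loc_iff :
    f ∈ L2loc Γ ↔ (∀ K : Set ℍ, IsCompact K → energy K f < ∞) ∧
      ∀ (g : PSL(2, ℤ)) (x : ℝ), energy (g • cuspStrip (Metric.ball x (1 / 2)) 1) f < ∞ := by
  refine ⟨fun hf => ⟨fun K => energy_lt_top_of_mem_L2loc hf, fun g x => ?_⟩, ?_⟩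
  · refine (energy_mono (Set.smul_set_mono fun z hz => ?_) f).trans_lt
      (energy_smul_cuspStrip_lt_top_of_mem_L2loc hf g (isCompact_closedBall x (1 / 2)))
    exact ⟨Metric.ball_subset_closedBall hz.1, hz.2⟩
  rintro ⟨hcompact, hcusp⟩ (z | ⟨c, p, hc, hp⟩)
  · obtain ⟨K, hK, hzK⟩ := exists_compact_mem_nhds z
    have hinner := BorelSerre.isOpenEmbedding_inner Γ
    refine ⟨_, hinner.image_mem_nhds.mpr hzK, ?_⟩
    rw [Set.preimage_image_eq _ hinner.injective, memLp_two_restrict_iff]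
    exact hcompact K hK
  · obtain ⟨h, rfl⟩ := isCusp_liftGL_iff.mp hc
    let g : SL(2, ℝ) := Matrix.SpecialLinearGroup.map (Int.castRingHom ℝ) h
    obtain ⟨x, hx⟩ : ∃ x : ℝ, (x : OnePoint ℝ) = (g : GL (Fin 2) ℝ)⁻¹ • p :=
      OnePoint.ne_infty_iff_exists.mp fun hinf => hp (inv_smul_eq_iff.mp hinf)
    refine ⟨cuspNhd Γ g (Metric.ball x (1 / 2)), (isOpen_cuspNhd g Metric.isOpen_ball).mem_nhds
      ⟨rfl, x, Metric.mem_ball_self one_half_pos, by rw [hx, smul_inv_smul]⟩, ?_⟩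
    refine memLp_two_restrict_iff.mpr ((energy_mono (fun z hz => ?_) f).trans_lt (hcusp h x))
    exact ⟨g⁻¹ • z, hz, smul_inv_smul g z⟩

variable [Γ.Normal] {q : ℕ}

theorem translation_mem_L2q (g : PSL(2, ℤ)) (hf : f ∈ L2q Γ q) : translation g f ∈ L2q Γ q := by
  refine ⟨?_, translation_mem_formsF g hf.2⟩
  obtain ⟨hcompact, hcusp⟩ := mem_L2loc_iff.mp hf.1
  refine mem_L2loc_iff.mpr ⟨fun K hK => ?_, fun g' x => ?_⟩
  · rw [energy_translation]
    exact hcompact _ (hK.smul g⁻¹)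
  · rw [energy_translation, smul_smul]
    exact hcusp _ x

theorem IsTameDomain.energy_lt_top {D : Set ℍ} (hD : IsTameDomain Γ volume D)
    (hf : f ∈ L2q Γ q) : energy D f < ∞ := by
  obtain ⟨K, F, hK, hF, hsub⟩ := hD.exists_subset_iUnion_smul_cuspStrip
  have hmeas : MeasurableSet (⋃ g ∈ F, g • cuspStrip (Set.Icc 0 Γ.index) 1) :=
    .biUnion hF.countable fun g _ => (measurableSet_cuspStrip measurableSet_Icc 1).const_smul g
  exact (energy_le_of_subset_iUnion_parSubgroup_smul hf.2 hD.isClosed.measurableSet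
    (fun _ _ => hD.aedisjoint) (hK.measurableSet.union hmeas) hsub).trans_lt
    (energy_union_lt_top (energy_lt_top_of_mem_L2loc hf.1 hK)
      (energy_biUnion_lt_top hF fun g _ =>
        energy_smul_cuspStrip_lt_top_of_mem_L2loc hf.1 g isCompact_Icc))

theorem DomainChoice.mem_L2q_iff (c : DomainChoice Γ) (hf : f ∈ formsF Γ q) :
    energy (c.tile q) f < ∞ ↔ f ∈ L2q Γ q := by
  have hD := c.isDomain.isTameDomain
  refine ⟨fun htile => ⟨?_, hf⟩, fun hfL2 => ?_⟩
  · have htranslates {F : Set Γ} (hF : F.Finite) : energy (⋃ γ ∈ F, γ • c.D) f < ∞ :=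
      energy_biUnion_lt_top hF fun γ _ => (c.energyDominated_smul q γ).energy_lt_top hf htile
    refine mem_L2loc_iff.mpr ⟨fun K hK => ?_, fun g x => ?_⟩
    · obtain ⟨F, hF, hsub⟩ := hD.exists_finite_subset_biUnion hK
      exact (energy_mono hsub f).trans_lt (htranslates hF)
    · obtain ⟨F, hF, hsub⟩ := hD.exists_smul_horoball_subset_iUnion g
      refine (energy_le_of_subset_iUnion_parSubgroup_smul hf
        ((measurableSet_cuspStrip measurableSet_ball 1).const_smul g) (fun p _ hp => ?_)
        (hD.measurableSet_biUnion_smul hF)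
        ((Set.smul_set_mono (cuspStrip_subset_horoball _)).trans hsub)).trans_lt (htranslates hF)
      exact (disjoint_smul_cuspStrip_ball g x (by simpa using hp)).aedisjoint
  · rw [c.tile_eq_biUnion]
    exact energy_biUnion_lt_top (c.finite_pow q) fun γ _ =>
      (hD.smul (γ : PSL(2, ℤ))).energy_lt_top hfL2

end BorelSerre

/-! ### The constant function and the functions attached to homomorphisms -/

section ConstantFunction

instance : (volume : Measure ℍ).IsOpenPosMeasure := by
  have := Measure.IsOpenPosMeasure.comap (volume : Measure ℂ) isOpenEmbedding_coe
  refine (withDensity_absolutelyContinuous' ?_ ?_).isOpenPosMeasure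
  · have hdensity : Continuous fun z : ℍ => (1 / NNReal.mk z.im z.im_pos.le : ℝ≥0) ^ 2 := by
      refine .pow (.div₀ continuous_const ?_ fun z => NNReal.ne_iff.mp z.im_ne_zero) _
      exact continuous_im.subtype_mk _
    exact hdensity.measurable.coe_nnreal_ennreal.aemeasurable
  · refine Filter.Eventually.of_forall fun z => ENNReal.coe_ne_zero.mpr (pow_ne_zero 2 ?_)
    exact one_div_ne_zero (NNReal.ne_iff.mp z.im_ne_zero)

theorem lintegral_Ioi_one_div_sq_lt_top {Y : ℝ} (hY : 0 < Y) :
    ∫⁻ y in Set.Ioi Y, ((1 / ‖y‖₊) ^ 2 : ℝ≥0) < ∞ := by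
  refine lt_of_eq_of_lt (setLIntegral_congr_fun measurableSet_Ioi fun y hy => ?_)
    (integrableOn_Ioi_rpow_of_lt (by norm_num : (-2 : ℝ) < -1) hY).2
  have hy0 : (0 : ℝ) < y := hY.trans hy
  rw [enorm_eq_nnnorm]
  congr 1
  ext
  simp [Real.rpow_neg hy0.le, abs_of_pos hy0]

theorem volume_cuspStrip_lt_top {I : Set ℝ} (hI : volume I < ∞) {Y : ℝ} (hY : 0 < Y) :
    volume (cuspStrip I Y) < ∞ := by
  let density : ℝ → ℝ≥0∞ := fun y => ((1 / ‖y‖₊) ^ 2 : ℝ≥0)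
  have hdensity : Measurable density := by fun_prop
  rw [volume_eq_lintegral]
  calc ∫⁻ z : ℂ in (↑) '' cuspStrip I Y, density z.im
      ≤ ∫⁻ z in Complex.measurableEquivRealProd ⁻¹' (I ×ˢ Set.Ioi Y),
          density (Complex.measurableEquivRealProd z).2 := by
        refine lintegral_mono_set ?_
        rintro _ ⟨z, hz, rfl⟩
        exact hz
    _ = ∫⁻ p in I ×ˢ Set.Ioi Y, 1 * density p.2 := by
        simp only [one_mul]
        exact Complex.volume_preserving_equiv_real_prod.setLIntegral_comp_preimage_emb
          Complex.measurableEquivRealProd.measurableEmbedding (fun p => density p.2) _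
    _ = volume I * ∫⁻ y in Set.Ioi Y, density y := by
        rw [Measure.volume_eq_prod, ← Measure.prod_restrict, lintegral_prod_mul aemeasurable_const
          hdensity.aemeasurable, setLIntegral_one]
    _ < ∞ := ENNReal.mul_lt_top hI (lintegral_Ioi_one_div_sq_lt_top hY)

theorem energy_eq_mul_measure_of_ae_eq_const {α E : Type*} [MeasurableSpace α] {μ : Measure α}
    [NormedAddCommGroup E] {A : Set α} {f : α →ₘ[μ] E} {b : E}
    (hf : f =ᵐ[μ.restrict A] fun _ => b) : energy A f = ‖b‖ₑ ^ (2 : ℝ) * μ A := by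
  rw [← setLIntegral_const, energy]
  refine lintegral_congr_ae ?_
  filter_upwards [hf] with x hx
  rw [hx]

theorem energy_one {α E : Type*} [MeasurableSpace α] {μ : Measure α} [NormedRing E]
    [NormOneClass E] (A : Set α) : energy A (1 : α →ₘ[μ] E) = μ A := by
  have hone : (1 : α →ₘ[μ] E) =ᵐ[μ.restrict A] fun _ => 1 := ae_restrict_of_ae AEEqFun.coeFn_one
  rw [energy_eq_mul_measure_of_ae_eq_const hone]
  simp

theorem IsTameDomain.measure_ne_zero {H X : Type*} [Group H] [TopologicalSpace X] [MulAction H X]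
    [MeasurableSpace X] {μ : Measure X} [NeZero μ] [SMulInvariantMeasure H X μ]
    {Γ : Subgroup H} [Countable Γ] {D : Set X}
    (hD : IsTameDomain Γ μ D) : μ D ≠ 0 := by
  intro h0
  refine NeZero.ne μ (Measure.measure_univ_eq_zero.mp ?_)
  rw [← hD.covers, measure_iUnion_null_iff]
  exact fun γ => (measure_smul μ (γ : H) D).trans h0

variable {Γ : Subgroup PSL(2, ℤ)}

theorem translation_one (γ : PSL(2, ℤ)) : translation γ 1 = 1 := rfl

theorem one_mem_formsF_zero : 1 ∈ formsF Γ 0 :=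
  mem_formsF_zero_iff.mpr fun γ => translation_one γ

variable [Γ.Normal] [Γ.FiniteIndex]

theorem one_mem_L2q (q : ℕ) : 1 ∈ L2q Γ q := by
  refine ⟨mem_L2loc_iff.mpr ⟨fun K hK => ?_, fun g x => ?_⟩,
    formsF_mono (Nat.zero_le q) one_mem_formsF_zero⟩
  · rw [energy_one]
    exact hK.measure_lt_top
  · rw [energy_one, measure_smul]
    exact volume_cuspStrip_lt_top measure_ball_lt_top one_pos

theorem IsTameDomain.volume_lt_top {D : Set ℍ} (hD : IsTameDomain Γ volume D) :
    volume D < ∞ := by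
  rw [← energy_one (E := ℂ)]
  exact hD.energy_lt_top (one_mem_L2q 0)

end ConstantFunction

section Homomorphism

variable {Γ : Subgroup PSL(2, ℤ)} {D : Set ℍ} {χ : Γ →* Multiplicative ℂ} {f : ℍ →ₘ[volume] ℂ}

theorem IsTameDomain.translation_eq_sub (hD : IsTameDomain Γ volume D)
    (hf : ∀ᵐ z, ∀ γ : Γ, z ∈ γ • D → f z = Multiplicative.toAdd (χ γ)) (γ : Γ) :
    translation (γ : PSL(2, ℤ)) f = f - Multiplicative.toAdd (χ γ) • 1 := by
  apply AEEqFun.ext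
  filter_upwards [translation_ae (γ : PSL(2, ℤ)) f, hf,
    (measurePreserving_smul (γ : PSL(2, ℤ))⁻¹ volume).quasiMeasurePreserving.ae hf,
    AEEqFun.coeFn_sub f (Multiplicative.toAdd (χ γ) • 1),
    AEEqFun.coeFn_smul (Multiplicative.toAdd (χ γ)) (1 : ℍ →ₘ[volume] ℂ),
    AEEqFun.coeFn_one (α := ℍ) (β := ℂ) (μ := volume)] with z htrans hz hγz hsub hsmul hone
  obtain ⟨δ, hδ⟩ := hD.exists_mem_smul z
  have hγδ : (γ : PSL(2, ℤ))⁻¹ • z ∈ (γ⁻¹ * δ) • D := by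
    rw [mul_smul]
    exact Set.smul_mem_smul_set (a := γ⁻¹) hδ
  rw [htrans, hγz _ hγδ, hsub, Pi.sub_apply, hz _ hδ, hsmul, Pi.smul_apply, hone, map_mul, map_inv,
    toAdd_mul, toAdd_inv]
  simp [sub_eq_neg_add]

variable [Γ.Normal]

theorem mem_formsF_one_of_translation_eq_sub (hχ : ∀ p ∈ parSubgroup Γ, χ p = 1)
    (hf : ∀ γ : Γ, translation (γ : PSL(2, ℤ)) f = f - Multiplicative.toAdd (χ γ) • 1) :
    f ∈ formsF Γ 1 := by
  refine mem_formsF_succ_iff.mpr ⟨fun γ => ?_, fun p hp => ?_⟩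
  · rw [hf, sub_sub_cancel_left]
    exact neg_mem ((formsF Γ 0).smul_mem _ one_mem_formsF_zero)
  · have hzero : (0 : ℂ) • (1 : ℍ →ₘ[volume] ℂ) = 0 := zero_smul ℂ (1 : ℍ →ₘ[volume] ℂ)
    rw [hf, hχ p hp, toAdd_one, hzero, sub_zero]

variable [Γ.FiniteIndex]

theorem DomainChoice.exists_translation_eq_sub (c : DomainChoice Γ) {q : ℕ} (hq : 1 ≤ q)
    (hχ : ∀ p ∈ parSubgroup Γ, χ p = 1) :
    ∃ f ∈ L2q Γ q, ∀ γ : Γ,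
      translation (γ : PSL(2, ℤ)) f = f - Multiplicative.toAdd (χ γ) • 1 := by
  have hD := c.isDomain.isTameDomain
  obtain ⟨F, hF, hFχ⟩ := hD.exists_measurable_ae_forall_eq_of_mem_smul
    fun γ => Multiplicative.toAdd (χ γ)
  let f : ℍ →ₘ[volume] ℂ := AEEqFun.mk F hF.aestronglyMeasurable
  have hf : ∀ᵐ z, ∀ γ : Γ, z ∈ γ • c.D → f z = Multiplicative.toAdd (χ γ) := by
    filter_upwards [AEEqFun.coeFn_mk F hF.aestronglyMeasurable, hFχ] with z hz hzχ
    rwa [hz]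
  have htrans := hD.translation_eq_sub hf
  have hfq : f ∈ formsF Γ q := formsF_mono hq (mem_formsF_one_of_translation_eq_sub hχ htrans)
  refine ⟨f, (c.mem_L2q_iff hfq).mp ?_, htrans⟩
  rw [c.tile_eq_biUnion]
  refine energy_biUnion_lt_top (c.finite_pow q) fun γ _ => ?_
  have hγD := hD.smul (γ : PSL(2, ℤ))
  have hconst : f =ᵐ[volume.restrict (γ • c.D)] fun _ => Multiplicative.toAdd (χ γ) :=
    (ae_restrict_iff' hγD.isClosed.measurableSet).mpr (hf.mono fun _ hz => hz γ)
  rw [energy_eq_mul_measure_of_ae_eq_const hconst]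
  exact ENNReal.mul_lt_top (by finiteness) hγD.volume_lt_top

end Homomorphism

/-! ### Limits of higher order invariant functions -/

section Limits

open Filter

variable {Γ : Subgroup PSL(2, ℤ)} {q : ℕ} {f : ℕ → ℍ →ₘ[volume] ℂ} {g : ℍ →ₘ[volume] ℂ}

theorem ae_tendsto_asAlgebraHom {D : Set ℍ} {T : Set Γ} {a : MonoidAlgebra ℂ Γ}
    (ha : a ∈ Submodule.span ℂ (MonoidAlgebra.of ℂ Γ '' T))
    (h : ∀ᵐ z, z ∈ T⁻¹ • D → Tendsto (fun n => f n z) atTop (𝓝 (g z))) :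
    ∀ᵐ z, z ∈ D →
      Tendsto (fun n => Representation.asAlgebraHom (translation.comp Γ.subtype) a (f n) z) atTop
        (𝓝 (Representation.asAlgebraHom (translation.comp Γ.subtype) a g z)) := by
  induction ha using Submodule.span_induction with
  | mem _ hγ =>
    obtain ⟨γ, hγ, rfl⟩ := hγ
    simp only [Representation.asAlgebraHom_of]
    filter_upwards [(measurePreserving_smul (γ : PSL(2, ℤ))⁻¹ volume).quasiMeasurePreserving.ae h,
      translation_ae (γ : PSL(2, ℤ)) g,
      ae_all_iff.mpr fun n => translation_ae (γ : PSL(2, ℤ)) (f n)]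
      with z hz hg hf hzD
    have hlim := hz (Set.smul_mem_smul (Set.inv_mem_inv.mpr hγ) hzD)
    simpa only [MonoidHom.comp_apply, Subgroup.coe_subtype, hg, hf] using hlim
  | zero =>
    simp only [map_zero, LinearMap.zero_apply]
    exact Eventually.of_forall fun z _ => tendsto_const_nhds
  | add a b _ _ ha hb =>
    simp only [map_add, LinearMap.add_apply]
    filter_upwards [ha, hb, AEEqFun.coeFn_add (Representation.asAlgebraHom _ a g) _,
      ae_all_iff.mpr fun n => AEEqFun.coeFn_add (Representation.asAlgebraHom _ a (f n)) _]
      with z hza hzb hg hf hzD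
    exact (((hza hzD).add (hzb hzD)).congr fun n => (hf n).symm).mono_right
      (congrArg 𝓝 hg.symm).le
  | smul b a _ ha =>
    simp only [map_smul, LinearMap.smul_apply]
    filter_upwards [ha, AEEqFun.coeFn_smul b (Representation.asAlgebraHom _ a g),
      ae_all_iff.mpr fun n => AEEqFun.coeFn_smul b (Representation.asAlgebraHom _ a (f n))]
      with z hza hg hf hzD
    exact (((hza hzD).const_smul b).congr fun n => (hf n).symm).mono_right
      (congrArg 𝓝 hg.symm).le

theorem mem_formsF_of_ae_tendsto (hf : ∀ n, f n ∈ formsF Γ q)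
    (h : ∀ᵐ z, Tendsto (fun n => f n z) atTop (𝓝 (g z))) : g ∈ formsF Γ q := by
  simp only [formsF, higherInvariants, Submodule.mem_iInf, LinearMap.mem_ker] at hf ⊢
  intro a ha
  have hspan := MonoidAlgebra.mem_span_support_coeff a
  apply AEEqFun.ext
  filter_upwards [ae_tendsto_asAlgebraHom (D := Set.univ) hspan (h.mono fun _ hz _ => hz)] with z hz
  simp only [hf _ a ha] at hz
  exact tendsto_nhds_unique (hz trivial) tendsto_const_nhds

namespace DomainChoice

theorem measurableSet_tile (c : DomainChoice Γ) (q : ℕ) : MeasurableSet (c.tile q) := by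
  rw [c.tile_eq_biUnion]
  exact c.isDomain.isTameDomain.measurableSet_biUnion_smul (c.finite_pow q)

theorem exists_ae_tendsto_of_tile (c : DomainChoice Γ) (hf : ∀ n, f n ∈ formsF Γ q)
    (h : ∀ᵐ z, z ∈ c.tile q → Tendsto (fun n => f n z) atTop (𝓝 (g z))) :
    ∃ G : ℍ →ₘ[volume] ℂ, ∀ᵐ z, Tendsto (fun n => f n z) atTop (𝓝 (G z)) := by
  have hlim (γ : Γ) : ∀ᵐ z, z ∈ γ • c.D → ∃ l, Tendsto (fun n => f n z) atTop (𝓝 l) := by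
    obtain ⟨a, ha, heq⟩ := exists_mem_span_pow_apply_eq (translation.comp Γ.subtype)
      (parSubgroup Γ) c.one_mem c.closure_eq_top q γ⁻¹
    have htile : c.tile q = (c.S ^ q)⁻¹ • c.D := by rw [← inv_pow, c.inv_eq, tile]
    rw [htile] at h
    filter_upwards [(measurePreserving_smul (γ : PSL(2, ℤ))⁻¹ volume).quasiMeasurePreserving.ae
      (ae_tendsto_asAlgebraHom ha h), (measurePreserving_smul (γ : PSL(2, ℤ))⁻¹
      volume).quasiMeasurePreserving.ae (ae_all_iff.mpr fun n =>
        translation_ae ((γ⁻¹ : Γ) : PSL(2, ℤ)) (f n))] with z hz htrans hzD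
    have hz := hz (Set.mem_smul_set_iff_inv_smul_mem.mp hzD)
    simp only [← heq _ (hf _)] at hz
    refine ⟨_, hz.congr fun n => (htrans n).trans ?_⟩
    rw [Subgroup.coe_inv, inv_inv, smul_inv_smul]
  obtain ⟨F, hF, hFlim⟩ := exists_stronglyMeasurable_limit_of_tendsto_ae
    (fun n => (f n).aestronglyMeasurable) (by
      filter_upwards [ae_all_iff.mpr hlim] with z hz
      exact (c.isDomain.isTameDomain.exists_mem_smul z).elim hz)
  refine ⟨AEEqFun.mk F hF.aestronglyMeasurable, ?_⟩
  filter_upwards [hFlim, AEEqFun.coeFn_mk F hF.aestronglyMeasurable] with z hz hmk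
  rwa [hmk]

end DomainChoice

end Limits

/-! ### The restriction maps -/

section InducedStructure

theorem norm_le_sqrt_mul_norm_of_enorm_sq_le {E F : Type*} [SeminormedAddCommGroup E]
    [SeminormedAddCommGroup F] {x : E} {y : F} {C : ℝ≥0} (h : ‖x‖ₑ ^ 2 ≤ C * ‖y‖ₑ ^ 2) :
    ‖x‖ ≤ NNReal.sqrt C * ‖y‖ := by
  have hsq : ‖x‖ ^ 2 ≤ C * ‖y‖ ^ 2 := by
    rw [enorm_eq_nnnorm, enorm_eq_nnnorm] at h
    exact_mod_cast h
  rw [Real.coe_sqrt, ← Real.sqrt_sq (norm_nonneg y), ← Real.sqrt_mul C.coe_nonneg]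
  exact Real.le_sqrt_of_sq_le hsq

section LinearMap

variable {R V E F : Type*} [Ring R] [AddCommMonoid V] [Module R V] [SeminormedAddCommGroup E]
  [Module R E]

theorem map_add_neg_one_smul (A : V →ₗ[R] E) (v w : V) : A (v + (-1 : R) • w) = A v - A w := by
  rw [map_add, map_smul, neg_one_smul, sub_eq_add_neg]

theorem induced_le_induced_of_norm_le [SeminormedAddCommGroup F] [Module R F] (A : V →ₗ[R] E)
    (B : V →ₗ[R] F) {C : ℝ≥0} (h : ∀ v, ‖B v‖ ≤ C * ‖A v‖) :
    TopologicalSpace.induced A inferInstance ≤ TopologicalSpace.induced B inferInstance := by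
  let _ := PseudoMetricSpace.induced A inferInstance
  have hlip : LipschitzWith C B := by
    refine LipschitzWith.of_dist_le_mul fun v w => ?_
    rw [dist_eq_norm, ← map_add_neg_one_smul]
    exact (h _).trans_eq (by rw [map_add_neg_one_smul, ← dist_eq_norm]; rfl)
  exact continuous_iff_le_induced.mp hlip.continuous

end LinearMap

theorem inner_map_eq_inner_map_of_forall_norm_eq {V E F : Type*} [AddCommMonoid V] [Module ℂ V]
    [SeminormedAddCommGroup E] [InnerProductSpace ℂ E] [SeminormedAddCommGroup F]
    [InnerProductSpace ℂ F] (A : V →ₗ[ℂ] E) (B : V →ₗ[ℂ] F) (h : ∀ v, ‖A v‖ = ‖B v‖) (v w : V) :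
    inner ℂ (A v) (A w) = inner ℂ (B v) (B w) := by
  rw [inner_eq_sum_norm_sq_div_four, inner_eq_sum_norm_sq_div_four (B v)]
  simp only [← map_smul, ← map_add, ← map_add_neg_one_smul, h]

end InducedStructure

section Restriction

variable {Γ : Subgroup PSL(2, ℤ)} [Γ.Normal] [Γ.FiniteIndex] {q : ℕ}

variable (Γ q) in
/-- The action of `Γ(1)` on `L²_q(Γ \ ℍ)` by translations. -/
noncomputable def L2qAction : Representation ℂ PSL(2, ℤ) (L2q Γ q) where
  toFun g := (translation g).restrict fun _ hf => translation_mem_L2q g hf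
  map_one' := by
    ext1 f
    exact Subtype.ext (by simp)
  map_mul' g h := by
    ext1 f
    exact Subtype.ext (by simp)

namespace DomainChoice

theorem memLp_tile (c : DomainChoice Γ) (f : L2q Γ q) :
    MemLp (f : ℍ →ₘ[volume] ℂ) 2 (volume.restrict (c.tile q)) :=
  memLp_two_restrict_iff.mpr ((c.mem_L2q_iff f.2.2).mpr f.2)

/-- The restriction map from `L²_q(Γ \ ℍ)` to `L²(S ^ q D)`. -/
noncomputable def restriction (c : DomainChoice Γ) (q : ℕ) :
    L2q Γ q →ₗ[ℂ] Lp ℂ 2 (volume.restrict (c.tile q)) where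
  toFun f := (c.memLp_tile f).toLp
  map_add' f g := by
    rw [← MemLp.toLp_add (c.memLp_tile f) (c.memLp_tile g)]
    exact MemLp.toLp_congr _ _ (ae_restrict_of_ae (AEEqFun.coeFn_add _ _))
  map_smul' a f := by
    rw [RingHom.id_apply, ← MemLp.toLp_const_smul a (c.memLp_tile f)]
    exact MemLp.toLp_congr _ _ (ae_restrict_of_ae (AEEqFun.coeFn_smul _ _))

theorem restriction_ae_eq (c : DomainChoice Γ) (f : L2q Γ q) :
    c.restriction q f =ᵐ[volume.restrict (c.tile q)] (f : ℍ →ₘ[volume] ℂ) :=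
  MemLp.coeFn_toLp (c.memLp_tile f)

theorem enorm_restriction_sq (c : DomainChoice Γ) (f : L2q Γ q) :
    ‖c.restriction q f‖ₑ ^ 2 = energy (c.tile q) (f : ℍ →ₘ[volume] ℂ) := by
  rw [← eLpNorm_two_restrict_sq, Lp.enorm_def, eLpNorm_congr_ae (c.restriction_ae_eq f)]

theorem enorm_restriction_action_sq (c : DomainChoice Γ) (g : PSL(2, ℤ)) (f : L2q Γ q) :
    ‖c.restriction q (L2qAction Γ q g f)‖ₑ ^ 2 =
      energy (g⁻¹ • c.tile q) (f : ℍ →ₘ[volume] ℂ) :=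
  (c.enorm_restriction_sq _).trans (energy_translation g _ _)

theorem restriction_injective (c : DomainChoice Γ) (q : ℕ) :
    Function.Injective (c.restriction q) := by
  intro f g hfg
  have hf := c.restriction_ae_eq f
  rw [hfg] at hf
  exact Subtype.ext (c.eq_of_ae_eq_tile f.2.2 g.2.2 (hf.symm.trans (c.restriction_ae_eq g)))

open Filter in
theorem isClosed_range_restriction (c : DomainChoice Γ) (q : ℕ) :
    IsClosed (Set.range (c.restriction q)) := by
  refine IsSeqClosed.isClosed fun x u hx hu => ?_
  choose f hf using hx
  obtain ⟨ns, -, hns⟩ := (tendstoInMeasure_of_tendsto_Lp hu).exists_seq_tendsto_ae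
  have htile : ∀ᵐ z ∂volume.restrict (c.tile q),
      Tendsto (fun n => (f (ns n) : ℍ →ₘ[volume] ℂ) z) atTop (𝓝 (u z)) := by
    filter_upwards [hns, ae_all_iff.mpr fun n => c.restriction_ae_eq (f (ns n))] with z hz hfz
    simpa only [← hf, hfz] using hz
  have hu := (Lp.stronglyMeasurable u).aestronglyMeasurable (μ := volume)
  obtain ⟨G, hG⟩ := c.exists_ae_tendsto_of_tile (g := AEEqFun.mk u hu) (fun n => (f (ns n)).2.2) (by
    filter_upwards [(ae_restrict_iff' (c.measurableSet_tile q)).mp htile, AEEqFun.coeFn_mk u hu]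
      with z hz hmk
    rwa [hmk])
  have hGF : G ∈ formsF Γ q := mem_formsF_of_ae_tendsto (fun n => (f (ns n)).2.2) hG
  have hGu : G =ᵐ[volume.restrict (c.tile q)] u := by
    filter_upwards [ae_restrict_of_ae hG, htile] with z hz hzu
    exact tendsto_nhds_unique hz hzu
  have hG2 : G ∈ L2q Γ q := by
    rw [← c.mem_L2q_iff hGF, ← memLp_two_restrict_iff, memLp_congr_ae hGu]
    exact Lp.memLp u
  exact ⟨⟨G, hG2⟩, Lp.ext ((c.restriction_ae_eq _).trans hGu)⟩

theorem exists_norm_restriction_action_le (c c' : DomainChoice Γ) (q : ℕ) (g : PSL(2, ℤ)) :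
    ∃ C : ℝ≥0, ∀ f, ‖c'.restriction q (L2qAction Γ q g f)‖ ≤ C * ‖c.restriction q f‖ := by
  obtain ⟨C, hC⟩ := c.energyDominated_smul_tile c' q g⁻¹
  refine ⟨NNReal.sqrt C, fun f => norm_le_sqrt_mul_norm_of_enorm_sq_le ?_⟩
  rw [c'.enorm_restriction_action_sq, c.enorm_restriction_sq]
  exact hC _ f.2.2

theorem induced_restriction_le (c c' : DomainChoice Γ) (q : ℕ) :
    TopologicalSpace.induced (c.restriction q) inferInstance ≤
      TopologicalSpace.induced (c'.restriction q) inferInstance := by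
  obtain ⟨C, hC⟩ := c.exists_norm_restriction_action_le c' q 1
  simp only [map_one, Module.End.one_apply] at hC
  exact induced_le_induced_of_norm_le (c.restriction q) (c'.restriction q) hC

theorem continuous_L2qAction (c : DomainChoice Γ) (q : ℕ) (g : PSL(2, ℤ)) :
    Continuous[TopologicalSpace.induced (c.restriction q) inferInstance,
      TopologicalSpace.induced (c.restriction q) inferInstance] (L2qAction Γ q g) := by
  obtain ⟨C, hC⟩ := c.exists_norm_restriction_action_le c q g
  rw [continuous_iff_le_induced, induced_compose]
  exact induced_le_induced_of_norm_le (c.restriction q) (c.restriction q ∘ₗ L2qAction Γ q g) hC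

end DomainChoice

end Restriction

/-! ### Dependence of the inner product on the choices -/

section Inner

variable {Γ : Subgroup PSL(2, ℤ)}

theorem IsTameDomain.energy_biUnion_smul [Γ.Normal] {D : Set ℍ} (hD : IsTameDomain Γ volume D)
    (F : Set Γ) {f : ℍ →ₘ[volume] ℂ} (hf : f ∈ formsF Γ 0) :
    energy (⋃ γ ∈ F, γ • D) f = ∑' _ : F, energy D f := by
  have hγD (γ : Γ) : IsTameDomain Γ volume (γ • D) := hD.smul (γ : PSL(2, ℤ))
  rw [Set.biUnion_eq_iUnion]
  refine (lintegral_iUnion₀ (fun γ : F => (hγD γ).isClosed.measurableSet.nullMeasurableSet)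
    (hD.pairwise_aedisjoint_smul.comp_of_injective Subtype.val_injective) _).trans ?_
  exact tsum_congr fun γ => (hγD γ).energy_eq hD hf

variable [Γ.FiniteIndex]

variable (Γ) in
theorem infinite_of_finiteIndex [Γ.Normal] : Infinite Γ :=
  Infinite.of_injective (fun k : ℤ => (cuspTranslation Γ 1 k : Γ))
    (Subtype.val_injective.comp (cuspTranslation_injective 1))

namespace DomainChoice

/-- The choice with the same fundamental domain in which `s` and its inverse are added to the
generators; it makes `S ^ q D` larger for `q ≥ 1` unless `s ∈ S ^ q`. -/
def adjoin (c : DomainChoice Γ) (s : Γ) : DomainChoice Γ where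
  S := c.S ∪ {s, s⁻¹}
  finite := c.finite.union (Set.toFinite _)
  one_mem := Or.inl c.one_mem
  symm t ht := by
    rcases ht with ht | rfl | rfl
    · exact Or.inl (c.symm t ht)
    · exact Or.inr (Or.inr rfl)
    · exact Or.inr (Or.inl (inv_inv s))
  generates := top_le_iff.mp (c.generates ▸ Subgroup.closure_mono Set.subset_union_left)
  D := c.D
  isDomain := c.isDomain

variable [Γ.Normal] {q : ℕ}

theorem volume_tile_lt_volume_tile_adjoin (c : DomainChoice Γ) (hq : 1 ≤ q) {s : Γ}
    (hs : s ∉ c.S ^ q) : volume (c.tile q) < volume ((c.adjoin s).tile q) := by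
  have hD := c.isDomain.isTameDomain
  have hpow : insert s (c.S ^ q) ⊆ (c.adjoin s).S ^ q := by
    refine Set.insert_subset ?_ (Set.pow_subset_pow_left Set.subset_union_left)
    have hsS : s ∈ (c.adjoin s).S := Or.inr (Or.inl rfl)
    exact Set.pow_subset_pow_right (c.adjoin s).one_mem hq ((pow_one (c.adjoin s).S).symm ▸ hsS)
  have hsub : c.tile q ∪ s • c.D ⊆ (c.adjoin s).tile q := by
    rw [tile_eq_biUnion, tile_eq_biUnion, Set.union_comm,
      ← Set.biUnion_insert s (c.S ^ q) fun γ => γ • c.D]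
    exact Set.biUnion_subset_biUnion_left hpow
  have hdisj : AEDisjoint volume (c.tile q) (s • c.D) := by
    simp only [tile_eq_biUnion, AEDisjoint.iUnion_left_iff]
    exact fun γ hγ => hD.pairwise_aedisjoint_smul (ne_of_mem_of_not_mem hγ hs)
  have hfin : volume (c.tile q) ≠ ∞ := by
    rw [← energy_one (E := ℂ)]
    exact ((c.mem_L2q_iff (one_mem_L2q q).2).mpr (one_mem_L2q q)).ne
  have hsD := hD.smul (s : PSL(2, ℤ))
  calc volume (c.tile q) < volume (c.tile q) + volume (s • c.D) :=
        ENNReal.lt_add_right hfin hsD.measure_ne_zero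
    _ = volume (c.tile q ∪ s • c.D) :=
        (measure_union₀ hsD.isClosed.measurableSet.nullMeasurableSet hdisj).symm
    _ ≤ volume ((c.adjoin s).tile q) := measure_mono hsub

theorem enorm_restriction_one_sq (c : DomainChoice Γ) :
    ‖c.restriction q ⟨1, one_mem_L2q q⟩‖ₑ ^ 2 = volume (c.tile q) :=
  (c.enorm_restriction_sq _).trans (energy_one _)

theorem exists_inner_ne (c : DomainChoice Γ) (hq : 1 ≤ q) :
    ∃ (c' : DomainChoice Γ) (f g : L2q Γ q),
      inner ℂ (c.restriction q f) (c.restriction q g) ≠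
        inner ℂ (c'.restriction q f) (c'.restriction q g) := by
  have := infinite_of_finiteIndex Γ
  obtain ⟨s, hs⟩ := (c.finite_pow q).exists_notMem
  let e : L2q Γ q := ⟨1, one_mem_L2q q⟩
  refine ⟨c.adjoin s, e, e, fun heq => (c.volume_tile_lt_volume_tile_adjoin hq hs).ne ?_⟩
  have hnorm : ‖c.restriction q e‖ = ‖(c.adjoin s).restriction q e‖ := by
    rw [norm_eq_sqrt_re_inner (𝕜 := ℂ), heq, ← norm_eq_sqrt_re_inner]
  rw [← c.enorm_restriction_one_sq, ← enorm_restriction_one_sq, enorm_eq_iff_norm_eq.mpr hnorm]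

theorem norm_restriction_action (c : DomainChoice Γ) (g : PSL(2, ℤ)) {f : L2q Γ q}
    (hf : (f : ℍ →ₘ[volume] ℂ) ∈ formsF Γ 0) :
    ‖c.restriction q (L2qAction Γ q g f)‖ = ‖c.restriction q f‖ := by
  have hD := c.isDomain.isTameDomain
  rw [← enorm_eq_iff_norm_eq, ← (ENNReal.pow_right_strictMono two_ne_zero).injective.eq_iff,
    c.enorm_restriction_sq, c.enorm_restriction_sq, c.tile_eq_biUnion, hD.energy_biUnion_smul _ hf]
  refine (hD.energy_biUnion_smul _ (translation_mem_formsF g hf)).trans (tsum_congr fun _ => ?_)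
  exact (energy_translation g _ _).trans ((hD.smul g⁻¹).energy_eq hD hf)

theorem inner_restriction_action (c : DomainChoice Γ) (h : formsF Γ q ≤ formsF Γ 0)
    (g : PSL(2, ℤ)) (f f' : L2q Γ q) :
    inner ℂ (c.restriction q (L2qAction Γ q g f)) (c.restriction q (L2qAction Γ q g f')) =
      inner ℂ (c.restriction q f) (c.restriction q f') :=
  inner_map_eq_inner_map_of_forall_norm_eq (c.restriction q ∘ₗ L2qAction Γ q g) (c.restriction q)
    (fun f => c.norm_restriction_action g (h f.2.2)) f f'

theorem hom_eq_one_of_inner_restriction_action (c : DomainChoice Γ) (hq : 1 ≤ q)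
    (h : ∀ (g : PSL(2, ℤ)) (f f' : L2q Γ q),
      inner ℂ (c.restriction q (L2qAction Γ q g f)) (c.restriction q (L2qAction Γ q g f')) =
        inner ℂ (c.restriction q f) (c.restriction q f'))
    {χ : Γ →* Multiplicative ℂ} (hχ : ∀ p ∈ parSubgroup Γ, χ p = 1) : χ = 1 := by
  obtain ⟨f, hf, hfχ⟩ := c.exists_translation_eq_sub hq hχ
  let e : L2q Γ q := ⟨1, one_mem_L2q q⟩
  have he : c.restriction q e ≠ 0 := by
    rw [← enorm_ne_zero, ← pow_ne_zero_iff two_ne_zero, c.enorm_restriction_one_sq]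
    exact ne_bot_of_le_ne_bot c.isDomain.isTameDomain.measure_ne_zero
      (measure_mono (c.subset_tile q))
  ext1 γ
  have hsum : L2qAction Γ q γ ⟨f, hf⟩ + Multiplicative.toAdd (χ γ) • e = ⟨f, hf⟩ :=
    Subtype.ext (eq_sub_iff_add_eq.mp (hfχ γ))
  have hrestr : c.restriction q ⟨f, hf⟩ = c.restriction q (L2qAction Γ q γ ⟨f, hf⟩) +
      Multiplicative.toAdd (χ γ) • c.restriction q e := by
    rw [← map_smul, ← map_add, hsum]
  have hinner : inner ℂ (c.restriction q e) (c.restriction q (L2qAction Γ q γ ⟨f, hf⟩)) =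
      inner ℂ (c.restriction q e) (c.restriction q ⟨f, hf⟩) := h γ e ⟨f, hf⟩
  rw [hrestr, inner_add_right, inner_smul_right, left_eq_add] at hinner
  exact (mul_eq_zero.mp hinner).resolve_right (inner_self_ne_zero.mpr he)

theorem unitary_iff (c : DomainChoice Γ) (q : ℕ) :
    (∀ (g : PSL(2, ℤ)) (f f' : L2q Γ q),
      inner ℂ (c.restriction q (L2qAction Γ q g f)) (c.restriction q (L2qAction Γ q g f')) =
        inner ℂ (c.restriction q f) (c.restriction q f')) ↔
      q = 0 ∨ ∀ χ : Γ →* Multiplicative ℂ, (∀ p ∈ parSubgroup Γ, χ p = 1) → χ = 1 := by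
  constructor
  · intro h
    refine or_iff_not_imp_left.mpr fun hq χ hχ => ?_
    exact c.hom_eq_one_of_inner_restriction_action (Nat.one_le_iff_ne_zero.mpr hq) h hχ
  · rintro (rfl | h)
    · exact c.inner_restriction_action le_rfl
    · exact c.inner_restriction_action (higherInvariants_eq_higherInvariants_zero _ _ h q).le

end DomainChoice

end Inner

theorem mainTheorem6_general (Γ : Subgroup PSL(2, ℤ)) [Γ.Normal] [Γ.FiniteIndex] (q : ℕ) :
    (∀ c : DomainChoice Γ, ∀ f ∈ formsF Γ q, ∀ g ∈ formsF Γ q,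
      f =ᵐ[volume.restrict (c.tile q)] g → f = g) ∧
    (∀ c : DomainChoice Γ, ∀ f ∈ formsF Γ q,
      MemLp f 2 (volume.restrict (c.tile q)) ↔ f ∈ L2q Γ q) ∧
    ∃ (π : Representation ℂ PSL(2, ℤ) (L2q Γ q))
      (ι : ∀ c : DomainChoice Γ, L2q Γ q →ₗ[ℂ] Lp ℂ 2 (volume.restrict (c.tile q))),
      (∀ γ f, (π γ f : ℍ →ₘ[volume] ℂ) = translation γ f) ∧
      (∀ c f, ι c f =ᵐ[volume.restrict (c.tile q)] (f : ℍ →ₘ[volume] ℂ)) ∧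
      (∀ c, Function.Injective (ι c) ∧ IsClosed (Set.range (ι c))) ∧
      (∀ c c', TopologicalSpace.induced (ι c) inferInstance =
        TopologicalSpace.induced (ι c') inferInstance) ∧
      (1 ≤ q → ∀ c, ∃ c', ∃ f g, inner ℂ (ι c f) (ι c g) ≠ inner ℂ (ι c' f) (ι c' g)) ∧
      (∀ c γ, Continuous[TopologicalSpace.induced (ι c) inferInstance,
        TopologicalSpace.induced (ι c) inferInstance] (π γ)) ∧
      (∀ c, (∀ γ f g, inner ℂ (ι c (π γ f)) (ι c (π γ g)) = inner ℂ (ι c f) (ι c g)) ↔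
        q = 0 ∨ ∀ χ : Γ →* Multiplicative ℂ, (∀ p ∈ parSubgroup Γ, χ p = 1) → χ = 1) :=
  ⟨fun c _ hf _ hg hfg => c.eq_of_ae_eq_tile hf hg hfg,
    fun c _ hf => memLp_two_restrict_iff.trans (c.mem_L2q_iff hf),
    L2qAction Γ q, fun c => c.restriction q, fun _ _ => rfl, fun c f => c.restriction_ae_eq f,
    fun c => ⟨c.restriction_injective q, c.isClosed_range_restriction q⟩,
    fun c c' => le_antisymm (c.induced_restriction_le c' q) (c'.induced_restriction_le c q),
    fun hq c => c.exists_inner_ne hq, fun c γ => c.continuous_L2qAction q γ,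
    fun c => c.unitary_iff q⟩

theorem mainTheorem6 (Γ : Subgroup PSL(2, ℤ)) [Γ.Normal] [Γ.FiniteIndex]
    (htf : ∀ γ ∈ Γ, IsOfFinOrder γ → γ = 1) (q : ℕ) :
    -- elements of `F_q` are determined by their restriction to `S^q D`
    (∀ c : DomainChoice Γ, ∀ f ∈ formsF Γ q, ∀ g ∈ formsF Γ q,
      f =ᵐ[volume.restrict (c.tile q)] g → f = g) ∧
    -- `F_q ∩ L²(S^q D) = L²_q(Γ \ ℍ)`
    (∀ c : DomainChoice Γ, ∀ f ∈ formsF Γ q,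
      MemLp f 2 (volume.restrict (c.tile q)) ↔ f ∈ L2q Γ q) ∧
    -- `π` is the action of `Γ(1)` on `L²_q(Γ \ ℍ)`, and `ι c` is the restriction to `S^q D`
    ∃ (π : Representation ℂ PSL(2, ℤ) (L2q Γ q))
      (ι : ∀ c : DomainChoice Γ, L2q Γ q →ₗ[ℂ] Lp ℂ 2 (volume.restrict (c.tile q))),
      (∀ γ f, (π γ f : ℍ →ₘ[volume] ℂ) = translation γ f) ∧
      (∀ c f, ι c f =ᵐ[volume.restrict (c.tile q)] (f : ℍ →ₘ[volume] ℂ)) ∧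
      -- it identifies `L²_q(Γ \ ℍ)` with a closed subspace of `L²(S^q D)`
      (∀ c, Function.Injective (ι c) ∧ IsClosed (Set.range (ι c))) ∧
      -- the topology is independent of the choices
      (∀ c c', TopologicalSpace.induced (ι c) inferInstance =
        TopologicalSpace.induced (ι c') inferInstance) ∧
      -- the inner product is not, for `q ≥ 1`
      (1 ≤ q → ∀ c, ∃ c', ∃ f g, inner ℂ (ι c f) (ι c g) ≠ inner ℂ (ι c' f) (ι c' g)) ∧
      -- the (discrete) group `Γ(1)` acts continuously
      (∀ c γ, Continuous[TopologicalSpace.induced (ι c) inferInstance,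
        TopologicalSpace.induced (ι c) inferInstance] (π γ)) ∧
      -- the action is unitary exactly if `q = 0` or there is no nonzero homomorphism
      -- `Γ / Γ_par → ℂ`
      (∀ c, (∀ γ f g, inner ℂ (ι c (π γ f)) (ι c (π γ g)) = inner ℂ (ι c f) (ι c g)) ↔
        q = 0 ∨ ∀ χ : Γ →* Multiplicative ℂ, (∀ p ∈ parSubgroup Γ, χ p = 1) → χ = 1) :=
  mainTheorem6_general Γ q
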